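/- For $N\ge 1$ let $\mathcal M_N\subset\mathbb R^N$ be the set of all vectors $(c_1(\eta),\dots,c_N(\eta))$, $c_k(\eta)=\int_0^1x^k\,\eta(dx)$, where $\eta$ runs through the probability measures on $[0,1]$. For each $n\ge 1$ let $C_{2n-1}=(C_{1,2n-1},\dots,C_{2n-1,2n-1})$ be a random vector that is uniformly distributed on $\mathcal M_{2n-1}$ (with respect to Lebesgue measure), and put $C_{0,2n-1}=1$. Fix $m\ge 1$. For $n\ge m$ let $$P_{m,n}(x)=\frac{\det\begin{pmatrix}C_{0,2n-1}&\cdots&C_{m-1,2n-1}&1\\ \vdots&&\vdots&\vdots\\ C_{m,2n-1}&\cdots&C_{2m-1,2n-1}&x^m\end{pmatrix}}{\det\big(C_{i+j,2n-1}\big)_{i,j=0}^{m-1}}$$ be the $m$-th random monic orthogonal polynomial. Almost surely it is well defined and all its roots are real; let $X_{1,n}\ge\dots\ge X_{m,n}$ denote these roots, listed with multiplicity in decreasing order. Let $T_j(x)=\cos(j\arccos(2x-1))$ and let $x_{k,m}=\tfrac12\big(\cos\big(\tfrac{(2k-1)\pi}{2m}\big)+1\big)$, $k=1,\dots,m$,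 be the zeros of $T_m$. Then $$4\sqrt n\,\big\{(X_{1,n},\dots,X_{m,n})^T-(x_{1,m},\dots,x_{m,m})^T\big\}\ \longrightarrow\ \mathcal N(0,\Gamma)$$ in distribution as $n\to\infty$, where $\Gamma=\frac{4}{m^2}(\gamma_{k,l})_{k,l=1}^m$ is positive semidefinite and $$\begin{aligned}\gamma_{k,l}={}&\tfrac14+\tfrac12\sum_{j=2}^{m}T_{j-1}^2(x_{k,m})T_{j-1}^2(x_{l,m})-\tfrac14\sum_{j=1}^{m-1}\big(T_{j-1}^2(x_{k,m})T_j^2(x_{l,m})+T_{j-1}^2(x_{l,m})T_j^2(x_{k,m})\big)\\&+\tfrac14T_1(x_{k,m})T_1(x_{l,m})+\tfrac12\sum_{j=2}^{m-1}T_{j-1}(x_{k,m})T_j(x_{k,m})T_{j-1}(x_{l,m})T_j(x_{l,m})\\&-\tfrac14\sum_{j=1}^{m-2}\big(T_{j-1}(x_{k,m})T_j(x_{k,m})T_j(x_{l,m})T_{j+1}(x_{l,m})+T_{j-1}(x_{l,m})T_j(x_{l,m})T_j(x_{k,m})T_{j+1}(x_{k,m})\big),\end{aligned}$$ empty sums being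 $0$. -/

import Mathlib

open MeasureTheory ProbabilityTheory Filter Topology

noncomputable section

namespace RandomOrthPoly

/-- The moment space of order `N`: all vectors `(c₁(η), …, c_N(η))` of moments of Borel probability
measures `η` concentrated on `[0,1]`. The coordinate with index `i : Fin N` is the moment of order
`i + 1`. -/
def momentSpace (N : ℕ) : Set (Fin N → ℝ) :=
  {c | ∃ η : Measure ℝ, IsProbabilityMeasure η ∧ η (Set.Icc (0 : ℝ) 1)ᶜ = 0 ∧
    ∀ i : Fin N, c i = ∫ x, x ^ ((i : ℕ) + 1) ∂η}

/-- The moment of order `k` recorded in a vector `c = (c₁, …, c_N)`, with `c₀ = 1`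
(and the value `0` for `k > N`, which is never used below when `2 * m - 1 ≤ N`). -/
def momentCoord {N : ℕ} (c : Fin N → ℝ) : ℕ → ℝ
  | 0 => 1
  | k + 1 => if h : k < N then c ⟨k, h⟩ else 0

/-- The Hankel determinant `det (c_{i+j})_{i,j=0,…,m-1}`. -/
def hankelDet {N : ℕ} (c : Fin N → ℝ) (m : ℕ) : ℝ :=
  (Matrix.of fun i j : Fin m => momentCoord c ((i : ℕ) + (j : ℕ))).det

/-- The monic orthogonal polynomial of degree `m` of the moment vector `c`: the determinant of the
`(m+1) × (m+1)` matrix whose `i`-th row is `(c_i, …, c_{i+m-1}, x^i)`, `i = 0, …, m`, divided by the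
Hankel determinant of size `m`. It involves the moments of order at most `2m - 1`. -/
def orthPoly {N : ℕ} (c : Fin N → ℝ) (m : ℕ) : Polynomial ℝ :=
  Polynomial.C (hankelDet c m)⁻¹ *
    (Matrix.of fun i j : Fin (m + 1) =>
      if (j : ℕ) < m then Polynomial.C (momentCoord c ((i : ℕ) + (j : ℕ)))
      else (Polynomial.X : Polynomial ℝ) ^ (i : ℕ)).det

/-- The real roots of `p`, with multiplicity and in decreasing order, as a vector in `ℝ^m`: the
coordinate with index `k : Fin m` is the `(k+1)`-st largest root (`0` if there is none). -/
def orderedRoots (p : Polynomial ℝ) (m : ℕ) : EuclideanSpace ℝ (Fin m) :=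
  WithLp.toLp 2 fun k : Fin m => (p.roots.sort (· ≥ ·)).getD (k : ℕ) 0

/-- The vector `(X_{1,n}, …, X_{m,n})` of the roots of the `m`-th orthogonal polynomial of a moment
vector `c` of order `2n - 1`. This polynomial exists only for `m ≤ n`; for `n < m` the vector is
put equal to `0` by convention. -/
def rootVector (m n : ℕ) (c : Fin (2 * n - 1) → ℝ) : EuclideanSpace ℝ (Fin m) :=
  if m ≤ n then orderedRoots (orthPoly c m) m else 0

/-- `T_j(x) = cos (j arccos (2x - 1))`, the Chebyshev polynomial of the first kind on `[0,1]`. -/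
def chebT (j : ℕ) (x : ℝ) : ℝ := Real.cos (j * Real.arccos (2 * x - 1))

/-- The zeros `x_{k,m} = (cos ((2k-1)π/(2m)) + 1) / 2`, `k = 1, …, m`, of `T_m`, in decreasing
order. The coordinate with index `k : Fin m` is `x_{k+1,m}`. -/
def chebRoots (m : ℕ) : EuclideanSpace ℝ (Fin m) :=
  WithLp.toLp 2 fun k : Fin m =>
    (Real.cos ((2 * ((k : ℕ) + 1 : ℝ) - 1) * (Real.pi / (2 * m))) + 1) / 2

/-- The numbers `γ_{k,l}`, as a function of `x = x_{k,m}` and `y = x_{l,m}`. -/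
def gammaFun (m : ℕ) (x y : ℝ) : ℝ :=
  1 / 4
  + 1 / 2 * ∑ j ∈ Finset.Icc 2 m, chebT (j - 1) x ^ 2 * chebT (j - 1) y ^ 2
  - 1 / 4 * ∑ j ∈ Finset.Icc 1 (m - 1),
      (chebT (j - 1) x ^ 2 * chebT j y ^ 2 + chebT (j - 1) y ^ 2 * chebT j x ^ 2)
  + 1 / 4 * (chebT 1 x * chebT 1 y)
  + 1 / 2 * ∑ j ∈ Finset.Icc 2 (m - 1),
      chebT (j - 1) x * chebT j x * chebT (j - 1) y * chebT j y
  - 1 / 4 * ∑ j ∈ Finset.Icc 1 (m - 2),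
      (chebT (j - 1) x * chebT j x * chebT j y * chebT (j + 1) y
        + chebT (j - 1) y * chebT j y * chebT j x * chebT (j + 1) x)

/-- The limiting covariance matrix `Γ = (2/m)² (γ_{k,l})`. -/
def limitCov (m : ℕ) : Matrix (Fin m) (Fin m) ℝ :=
  Matrix.of fun k l => (2 / (m : ℝ)) ^ 2 * gammaFun m (chebRoots m k) (chebRoots m l)

end RandomOrthPoly

end

noncomputable section

open Polynomial

namespace RandomOrthPoly

/-! ### Szegő polynomials with real Verblunsky coefficients -/

/-! Under x = (1 + cos θ)/2 a measure on [0,1] lifts to a measure on the unit circle symmetric under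
conjugation, described by real Verblunsky coefficients a_k in [-1,1]. In these coordinates the
uniform law on the moment space becomes a product law: the moment of order k+1 involves only a_0, …,
a_k and is affine in a_k, with slope a constant times ∏_{j<k} (1 - a_j²). The Jacobian is therefore
triangular, and the a_j are independent with densities proportional to (1 - a²)^{N-1-j}
(`det_fderiv_momentMap`, `cond_momentSpace`). That the open cube (-1,1)^N fills the moment space up
to a null set has two halves: every measure has coefficients (`exists_trigMoment_eq`), and every
point of the open cube comes from a measure, namely the Bernstein–Szegő measure
(`exists_measure_trigInt_eq`).

The m-th orthogonal polynomial is a multiple of Re(z^{1-m} Φ_{2m-1}(z)), with Φ_k the Szegő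
polynomials (`orthPoly_momentMap`). It depends on the first 2m-1 coefficients only, by a formula
free of n. For N = 2n-1 each of these coefficients, times 2√n, is asymptotically standard normal,
since (1 - s²/(4n))^{2n-2-j} → exp(-s²/2). At a = 0 the polynomial is a multiple of T_m, whose zeros
are simple, so along each ray the roots move linearly to first order
(`tendsto_scaled_orderedRoots`). The limit is thus J s with s standard Gaussian and J =
`rootJacobian m`; its covariance J Jᵀ is rewritten as Γ by trigonometric identities (`limitCov_eq`).

The passage to the limit is made on densities: those of the rescaled coefficients converge pointwise
under a Gaussian bound, so dominated convergence applies even to test functions that vary with n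
(`tendsto_integral_firstCoeffLaw`). Only the behaviour of the roots along each fixed direction s is
needed. -/

/-- The pair of the Szegő polynomial of degree `k` and its reversal. -/
def szegoPair (a : ℕ → ℝ) : ℕ → ℝ[X] × ℝ[X]
  | 0 => (1, 1)
  | k + 1 => (X * (szegoPair a k).1 - C (a k) * (szegoPair a k).2,
      (szegoPair a k).2 - C (a k) * (X * (szegoPair a k).1))

/-- The monic Szegő polynomial of degree `k` with Verblunsky coefficients `a`. -/
def szego (a : ℕ → ℝ) (k : ℕ) : ℝ[X] := (szegoPair a k).1

/-- The reversed Szegő polynomial. -/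
def szegoRev (a : ℕ → ℝ) (k : ℕ) : ℝ[X] := (szegoPair a k).2

/-- The squared norm of the Szegő polynomial of degree `k`. -/
def szegoNorm (a : ℕ → ℝ) (k : ℕ) : ℝ := ∏ j ∈ Finset.range k, (1 - a j ^ 2)

variable (a : ℕ → ℝ)

@[simp] lemma szego_zero : szego a 0 = 1 := rfl

@[simp] lemma szegoRev_zero : szegoRev a 0 = 1 := rfl

@[simp] lemma szegoNorm_zero : szegoNorm a 0 = 1 := by simp [szegoNorm]

lemma szego_succ (k : ℕ) : szego a (k + 1) = X * szego a k - C (a k) * szegoRev a k := rfl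

lemma szegoRev_succ (k : ℕ) :
    szegoRev a (k + 1) = szegoRev a k - C (a k) * (X * szego a k) := rfl

lemma szegoNorm_succ (k : ℕ) : szegoNorm a (k + 1) = szegoNorm a k * (1 - a k ^ 2) := by
  simp [szegoNorm, Finset.prod_range_succ]

lemma szego_degree_aux (k : ℕ) :
    ((szego a k).Monic ∧ (szego a k).natDegree = k) ∧ (szegoRev a k).natDegree ≤ k := by
  induction k with
  | zero => simp
  | succ k ih =>
    obtain ⟨⟨h1, h2⟩, h3⟩ := ih
    have hX : (X * szego a k).Monic := monic_X.mul h1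
    have hXd : (X * szego a k).natDegree = k + 1 := by
      rw [monic_X.natDegree_mul h1, natDegree_X, h2, add_comm]
    have hlt : (C (a k) * szegoRev a k).degree < (X * szego a k).degree := by
      rw [degree_eq_natDegree hX.ne_zero, hXd]
      refine (degree_le_natDegree).trans_lt ?_
      exact_mod_cast (natDegree_C_mul_le _ _).trans_lt (Nat.lt_succ_of_le h3)
    refine ⟨⟨hX.sub_of_left hlt, ?_⟩, ?_⟩
    · rw [szego_succ, natDegree_sub_eq_left_of_natDegree_lt, hXd]
      rw [hXd]
      exact (natDegree_C_mul_le _ _).trans_lt (Nat.lt_succ_of_le h3)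
    · rw [szegoRev_succ]
      refine (natDegree_sub_le _ _).trans (max_le (h3.trans k.le_succ) ?_)
      exact (natDegree_C_mul_le _ _).trans hXd.le

lemma szego_monic (k : ℕ) : (szego a k).Monic := (szego_degree_aux a k).1.1

lemma szego_natDegree (k : ℕ) : (szego a k).natDegree = k := (szego_degree_aux a k).1.2

lemma szego_coeff_self (k : ℕ) : (szego a k).coeff k = 1 := by
  simpa [szego_natDegree] using (szego_monic a k).coeff_natDegree

variable {a} in
lemma szegoPair_congr {b : ℕ → ℝ} {k : ℕ} (h : ∀ j < k, a j = b j) :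
    szegoPair a k = szegoPair b k := by
  induction k with
  | zero => rfl
  | succ k ih =>
    simp only [szegoPair]
    rw [ih fun j hj => h j (hj.trans k.lt_succ_self), h k k.lt_succ_self]

variable {a} in
lemma szego_congr {b : ℕ → ℝ} {k : ℕ} (h : ∀ j < k, a j = b j) : szego a k = szego b k := by
  rw [szego, szegoPair_congr h, szego]

variable {a} in
lemma szegoNorm_congr {b : ℕ → ℝ} {k : ℕ} (h : ∀ j < k, a j = b j) :
    szegoNorm a k = szegoNorm b k :=
  Finset.prod_congr rfl fun j hj => by rw [h j (Finset.mem_range.1 hj)]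

variable {a} in
lemma szegoNorm_pos {k : ℕ} (h : ∀ j < k, |a j| < 1) : 0 < szegoNorm a k :=
  Finset.prod_pos fun j hj => by
    have := (sq_lt_one_iff_abs_lt_one (a j)).2 (h j (Finset.mem_range.1 hj))
    linarith

/-! ### Toeplitz functionals -/

/-- The functional `f ↦ ∑ fᵢ τ(i - j)`. -/
def toeplitz (τ : ℤ → ℝ) (j : ℤ) : ℝ[X] →ₗ[ℝ] ℝ :=
  Polynomial.lsum fun i => τ (i - j) • LinearMap.id

lemma toeplitz_eq_sum (τ : ℤ → ℝ) (j : ℤ) {f : ℝ[X]} {n : ℕ} (hf : f.natDegree < n) :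
    toeplitz τ j f = ∑ i ∈ Finset.range n, τ (i - j) * f.coeff i :=
  Polynomial.sum_over_range' _ (by simp) _ hf

lemma toeplitz_C_mul (τ : ℤ → ℝ) (j : ℤ) (c : ℝ) (f : ℝ[X]) :
    toeplitz τ j (C c * f) = c * toeplitz τ j f := by
  rw [← smul_eq_C_mul, map_smul, smul_eq_mul]

@[simp] lemma toeplitz_one (τ : ℤ → ℝ) (j : ℤ) : toeplitz τ j 1 = τ (-j) := by
  rw [toeplitz_eq_sum (n := 1) _ _ (by simp)]
  simp

/-- For trigonometric moments τ of a symmetric measure, `toeplitz τ j f` is the pairing of f with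
z^j on the circle, so multiplying f by z is the same as dividing z^j by z. -/
lemma toeplitz_X_mul (τ : ℤ → ℝ) (j : ℤ) (f : ℝ[X]) :
    toeplitz τ j (X * f) = toeplitz τ (j - 1) f := by
  have hn : (X * f).natDegree < f.natDegree + 2 := by
    refine (natDegree_mul_le).trans_lt ?_
    rw [natDegree_X]; omega
  rw [toeplitz_eq_sum _ _ hn, toeplitz_eq_sum _ _ (Nat.lt_succ_self f.natDegree),
    Finset.sum_range_succ']
  simp only [coeff_X_mul, coeff_X_mul_zero, mul_zero, add_zero]
  refine Finset.sum_congr rfl fun i _ => ?_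
  congr 2
  push_cast; ring

lemma toeplitz_szego_succ (τ : ℤ → ℝ) (j : ℤ) (k : ℕ) :
    toeplitz τ j (szego a (k + 1)) =
      toeplitz τ (j - 1) (szego a k) - a k * toeplitz τ j (szegoRev a k) := by
  rw [szego_succ, map_sub, toeplitz_X_mul, toeplitz_C_mul]

lemma toeplitz_szegoRev_succ (τ : ℤ → ℝ) (j : ℤ) (k : ℕ) :
    toeplitz τ j (szegoRev a (k + 1)) =
      toeplitz τ j (szegoRev a k) - a k * toeplitz τ (j - 1) (szego a k) := by
  rw [szegoRev_succ, map_sub, toeplitz_C_mul, toeplitz_X_mul]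

variable {a} in
-- Writing L_j for the pairing with z^j: L_0(Φ_{k+1}) = 0 says that L_{-1}(Φ_k) = a_k L_0(Φ*_k). The
-- recursion for Φ* then multiplies L_0(Φ*_k) by 1 - a_k².
lemma toeplitz_szegoRev_zero {τ : ℤ → ℝ} {N : ℕ}
    (h0 : ∀ k, 1 ≤ k → k ≤ N → toeplitz τ 0 (szego a k) = 0) {k : ℕ} (hk : k ≤ N) :
    toeplitz τ 0 (szegoRev a k) = szegoNorm a k * τ 0 := by
  induction k with
  | zero => simp
  | succ k ih =>
    have h1 := h0 (k + 1) (by omega) hk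
    rw [toeplitz_szego_succ, ih (by omega)] at h1
    rw [toeplitz_szegoRev_succ, ih (by omega), szegoNorm_succ]
    linear_combination (-a k) * h1

section Even

variable {τ : ℤ → ℝ}

/-- Evenness of τ is the conjugation symmetry of the measure. On the circle Φ*_k = z^k conj(Φ_k),
which exchanges the pairings with z^j and z^{k-j}. -/
lemma toeplitz_szegoRev (hτ : ∀ j, τ (-j) = τ j) (k : ℕ) (j : ℤ) :
    toeplitz τ j (szegoRev a k) = toeplitz τ (k - j) (szego a k) := by
  induction k generalizing j with
  | zero => simp [hτ]
  | succ k ih =>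
    rw [toeplitz_szegoRev_succ, toeplitz_szego_succ, ih, ih]
    push_cast
    have h1 : (k : ℤ) + 1 - j - 1 = k - j := by ring
    have h2 : (k : ℤ) - (k + 1 - j) = j - 1 := by ring
    rw [h1, h2]

variable {a}

/-- For 1 ≤ j ≤ k the recursion expresses the pairing of Φ_{k+1} with z^j through those of Φ_k with
z^{j-1} and z^{k-j}, both of order below k. Hence orthogonality to 1 in every degree is enough. -/
lemma toeplitz_szego_eq_zero (hτ : ∀ j, τ (-j) = τ j) {N : ℕ} (h0 : ∀ k, 1 ≤ k → k ≤ N → toeplitz τ 0 (szego a k) = 0)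
    {k : ℕ} (hk : k ≤ N) {j : ℤ} (hj : 0 ≤ j) (hjk : j < k) : toeplitz τ j (szego a k) = 0 := by
  induction k generalizing j with
  | zero => simp at hjk; omega
  | succ k ih =>
    obtain rfl | hj' := hj.eq_or_lt
    · exact h0 _ (by omega) hk
    · push_cast at hjk
      rw [toeplitz_szego_succ, toeplitz_szegoRev a hτ,
        ih (by omega) (by omega) (by omega), ih (by omega) (by omega) (by omega)]
      simp

lemma toeplitz_szego_self (hτ : ∀ j, τ (-j) = τ j) {N : ℕ}
    (h0 : ∀ k, 1 ≤ k → k ≤ N → toeplitz τ 0 (szego a k) = 0) {k : ℕ} (hk : k ≤ N) :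
    toeplitz τ k (szego a k) = szegoNorm a k * τ 0 := by
  rw [← toeplitz_szegoRev_zero h0 hk, toeplitz_szegoRev a hτ, sub_zero]

end Even

/-! ### Trigonometric moments from Verblunsky coefficients -/

/-- The trigonometric moments of a measure with Verblunsky coefficients `a`. -/
def trigMoment (a : ℕ → ℝ) : ℕ → ℝ
  | 0 => 1
  | k + 1 => a k * szegoNorm a k - ∑ i : Fin k, (szego a k).coeff i * trigMoment a (i + 1)
decreasing_by omega

@[simp] lemma trigMoment_zero : trigMoment a 0 = 1 := by rw [trigMoment]

lemma trigMoment_succ (k : ℕ) : trigMoment a (k + 1) =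
    a k * szegoNorm a k - ∑ i ∈ Finset.range k, (szego a k).coeff i * trigMoment a (i + 1) := by
  rw [trigMoment, Finset.sum_range fun i => (szego a k).coeff i * trigMoment a (i + 1)]

variable {a} in
lemma trigMoment_congr {b : ℕ → ℝ} {k : ℕ} (h : ∀ j < k, a j = b j) :
    trigMoment a k = trigMoment b k := by
  induction k using Nat.strong_induction_on with
  | _ k ih =>
    cases k with
    | zero => simp
    | succ k =>
      have h' : ∀ j < k, a j = b j := fun j hj => h j (by omega)
      rw [trigMoment_succ, trigMoment_succ, h k k.lt_succ_self, szego_congr h', szegoNorm_congr h']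
      congr 1
      refine Finset.sum_congr rfl fun i hi => ?_
      have := Finset.mem_range.1 hi
      rw [ih (i + 1) (by omega) fun j hj => h j (by omega)]

/-- Since Φ_k is monic, the new moment enters with coefficient one, so that orthogonality of Φ_{k+1}
to 1 can be solved for it. This solution is the recursion defining `trigMoment`. -/
lemma toeplitz_neg_one_szego (τ : ℤ → ℝ) (k : ℕ) :
    toeplitz τ (-1) (szego a k) =
      τ (k + 1) + ∑ i ∈ Finset.range k, (szego a k).coeff i * τ (i + 1) := by
  rw [toeplitz_eq_sum (n := k + 1) _ _ (by rw [szego_natDegree]; omega), Finset.sum_range_succ,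
    szego_coeff_self, add_comm]
  simp [mul_comm]

variable {a} in
/-- The vanishing of the functional at the Szegő polynomials characterizes the moments. -/
lemma toeplitz_szego_zero_iff {τ : ℤ → ℝ} (hτ0 : τ 0 = 1) (N : ℕ) :
    (∀ k, 1 ≤ k → k ≤ N → toeplitz τ 0 (szego a k) = 0) ↔
      ∀ k ≤ N, τ k = trigMoment a k := by
  induction N with
  | zero => simp [hτ0]; intro k h1 h2; omega
  | succ N ih =>
    have key : (∀ k, 1 ≤ k → k ≤ N → toeplitz τ 0 (szego a k) = 0) → (∀ k ≤ N, τ k = trigMoment a k)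
        → (toeplitz τ 0 (szego a (N + 1)) = 0 ↔ τ (N + 1 : ℕ) = trigMoment a (N + 1)) := by
      intro h1 h2
      rw [toeplitz_szego_succ, toeplitz_szegoRev_zero h1 le_rfl, zero_sub,
        toeplitz_neg_one_szego, trigMoment_succ, hτ0]
      have : ∑ i ∈ Finset.range N, (szego a N).coeff i * τ (i + 1) =
          ∑ i ∈ Finset.range N, (szego a N).coeff i * trigMoment a (i + 1) :=
        Finset.sum_congr rfl fun i hi => by
          have := h2 (i + 1) (by have := Finset.mem_range.1 hi; omega)
          push_cast at this
          rw [this]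
      rw [this]
      push_cast
      constructor <;> intro h <;> linarith
    constructor
    · intro h k hk
      have h1 : ∀ k, 1 ≤ k → k ≤ N → toeplitz τ 0 (szego a k) = 0 :=
        fun k h1 h2 => h k h1 (by omega)
      have h2 := ih.1 h1
      obtain h3 | rfl := Nat.le_succ_iff.1 hk
      · exact h2 k h3
      · exact (key h1 h2).1 (h _ (by omega) le_rfl)
    · intro h k hk1 hk
      have h2 : ∀ k ≤ N, τ k = trigMoment a k := fun k h2 => h k (by omega)
      have h1 := ih.2 h2
      obtain h3 | rfl := Nat.le_succ_iff.1 hk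
      · exact h1 k hk1 h3
      · exact (key h1 h2).2 (h _ le_rfl)

end RandomOrthPoly
end

noncomputable section

open Polynomial

namespace RandomOrthPoly

/-! ### Measures on the unit interval and their lift to the circle -/

/-- The angle `θ ∈ [0, π]` with `x = (1 + cos θ) / 2`. -/
def angle (x : ℝ) : ℝ := Real.arccos (2 * x - 1)

/-- The point of the upper half circle over `x`. -/
def circlePt (x : ℝ) : ℂ := Complex.exp (angle x * Complex.I)

/-- The trigonometric moments of a measure on the unit interval. -/
def trigInt (η : Measure ℝ) (j : ℤ) : ℝ := ∫ x, Real.cos (j * angle x) ∂η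

lemma continuous_angle : Continuous angle := by
  unfold angle; fun_prop

lemma continuous_circlePt : Continuous circlePt := by
  unfold circlePt
  have := continuous_angle
  fun_prop

lemma norm_circlePt (x : ℝ) : ‖circlePt x‖ = 1 := Complex.norm_exp_ofReal_mul_I _

lemma circlePt_ne_zero (x : ℝ) : circlePt x ≠ 0 := Complex.exp_ne_zero _

lemma exp_mul_I_zpow (φ : ℝ) (n : ℤ) :
    Complex.exp (φ * Complex.I) ^ n = Complex.exp ((n * φ : ℝ) * Complex.I) := by
  rw [← Complex.exp_int_mul]
  push_cast; ring_nf

lemma trigInt_neg (η : Measure ℝ) (j : ℤ) : trigInt η (-j) = trigInt η j := by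
  simp [trigInt]

lemma trigInt_zero (η : Measure ℝ) [IsProbabilityMeasure η] : trigInt η 0 = 1 := by
  simp [trigInt]

lemma integrable_cos_angle (η : Measure ℝ) [IsFiniteMeasure η] (j : ℤ) :
    Integrable (fun x => Real.cos (j * angle x)) η := by
  have := continuous_angle
  refine Integrable.of_bound (C := 1) (by fun_prop) (ae_of_all _ fun x => ?_)
  exact Real.abs_cos_le_one _

lemma aeval_exp_mul_zpow_re (f : ℝ[X]) (j : ℤ) (φ : ℝ) :
    (aeval (Complex.exp (φ * Complex.I)) f * Complex.exp (φ * Complex.I) ^ (-j)).re =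
      ∑ i ∈ Finset.range (f.natDegree + 1), Real.cos (((i : ℤ) - j : ℤ) * φ) * f.coeff i := by
  rw [aeval_eq_sum_range, Finset.sum_mul, Complex.re_sum]
  refine Finset.sum_congr rfl fun i _ => ?_
  rw [← Complex.exp_ofReal_mul_I_re, ← exp_mul_I_zpow, Algebra.smul_def, mul_assoc,
    ← zpow_natCast, ← zpow_add₀ (Complex.exp_ne_zero _), mul_comm _ (f.coeff i), ← sub_eq_add_neg]
  exact Complex.re_ofReal_mul _ _

lemma aeval_mul_zpow_re (f : ℝ[X]) (j : ℤ) (x : ℝ) :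
    (aeval (circlePt x) f * circlePt x ^ (-j)).re =
      ∑ i ∈ Finset.range (f.natDegree + 1), Real.cos (((i : ℤ) - j : ℤ) * angle x) * f.coeff i :=
  aeval_exp_mul_zpow_re f j _

/-- The Toeplitz functional of a measure is integration on the circle. -/
lemma toeplitz_trigInt (η : Measure ℝ) [IsFiniteMeasure η] (j : ℤ) (f : ℝ[X]) :
    toeplitz (trigInt η) j f = ∫ x, (aeval (circlePt x) f * circlePt x ^ (-j)).re ∂η := by
  simp_rw [aeval_mul_zpow_re]
  rw [integral_finsetSum _ fun i _ => (integrable_cos_angle η _).mul_const _,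
    toeplitz_eq_sum _ _ (Nat.lt_succ_self _)]
  refine Finset.sum_congr rfl fun i _ => ?_
  rw [integral_mul_const, trigInt]

lemma conj_circlePt_pow (x : ℝ) (i : ℕ) :
    (starRingEnd ℂ) (circlePt x ^ i) = circlePt x ^ (-(i : ℤ)) := by
  rw [zpow_neg, zpow_natCast, map_pow, ← inv_pow, Complex.inv_def, Complex.normSq_eq_norm_sq,
    norm_circlePt]
  simp

lemma mul_conj_aeval_re (f g : ℝ[X]) (x : ℝ) :
    (aeval (circlePt x) f * (starRingEnd ℂ) (aeval (circlePt x) g)).re =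
      ∑ i ∈ Finset.range (g.natDegree + 1),
        g.coeff i * (aeval (circlePt x) f * circlePt x ^ (-(i : ℤ))).re := by
  rw [aeval_eq_sum_range (p := g), map_sum, Finset.mul_sum, Complex.re_sum]
  refine Finset.sum_congr rfl fun i _ => ?_
  rw [Algebra.smul_def, map_mul, conj_circlePt_pow, ← Complex.re_ofReal_mul]
  simp only [Complex.coe_algebraMap, Complex.conj_ofReal]
  ring_nf

lemma integrable_aeval_mul_zpow (η : Measure ℝ) [IsFiniteMeasure η] (f : ℝ[X]) (j : ℤ) :
    Integrable (fun x => (aeval (circlePt x) f * circlePt x ^ (-j)).re) η := by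
  simp_rw [aeval_mul_zpow_re]
  exact integrable_finsetSum _ fun i _ => (integrable_cos_angle η _).mul_const _

lemma integral_mul_conj_aeval_re (η : Measure ℝ) [IsFiniteMeasure η] (f g : ℝ[X]) :
    ∫ x, (aeval (circlePt x) f * (starRingEnd ℂ) (aeval (circlePt x) g)).re ∂η =
      ∑ i ∈ Finset.range (g.natDegree + 1), g.coeff i * toeplitz (trigInt η) i f := by
  simp_rw [mul_conj_aeval_re, toeplitz_trigInt]
  rw [integral_finsetSum]
  · exact Finset.sum_congr rfl fun i _ => integral_const_mul _ _
  · exact fun i _ => (integrable_aeval_mul_zpow η f i).const_mul _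

variable {a : ℕ → ℝ} {η : Measure ℝ}

/-- The Szegő polynomial is orthogonal to the polynomials of lower degree. -/
lemma integral_mul_conj_szego [IsProbabilityMeasure η] {N : ℕ}
    (h : ∀ k ≤ N, trigInt η k = trigMoment a k) {k : ℕ} (hk : k ≤ N) {g : ℝ[X]}
    (hg : g.natDegree ≤ k) :
    ∫ x, (aeval (circlePt x) (szego a k) * (starRingEnd ℂ) (aeval (circlePt x) g)).re ∂η =
      g.coeff k * szegoNorm a k := by
  have h0 := (toeplitz_szego_zero_iff (trigInt_zero η) N).2 h
  have hvan : ∀ i < k, toeplitz (trigInt η) i (szego a k) = 0 := fun i hi =>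
    toeplitz_szego_eq_zero (trigInt_neg η) h0 hk (by omega) (by omega)
  rw [integral_mul_conj_aeval_re]
  obtain hg | rfl := hg.lt_or_eq
  · rw [coeff_eq_zero_of_natDegree_lt hg, zero_mul]
    refine Finset.sum_eq_zero fun i hi => ?_
    rw [hvan i (by have := Finset.mem_range.1 hi; omega), mul_zero]
  · rw [Finset.sum_range_succ, toeplitz_szego_self (trigInt_neg η) h0 hk, trigInt_zero, mul_one,
      Finset.sum_eq_zero, zero_add]
    intro i hi
    rw [hvan i (Finset.mem_range.1 hi), mul_zero]

lemma integral_norm_sq_szego [IsProbabilityMeasure η] {N : ℕ}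
    (h : ∀ k ≤ N, trigInt η k = trigMoment a k) {k : ℕ} (hk : k ≤ N) :
    ∫ x, ‖aeval (circlePt x) (szego a k)‖ ^ 2 ∂η = szegoNorm a k := by
  have := integral_mul_conj_szego h hk (szego_natDegree a k).le
  rw [szego_coeff_self, one_mul] at this
  rw [← this]
  congr with x
  rw [Complex.mul_conj, Complex.ofReal_re, Complex.normSq_eq_norm_sq]

lemma continuous_aeval_circlePt (f : ℝ[X]) : Continuous fun x => aeval (circlePt x) f :=
  (Polynomial.continuous_aeval f).comp continuous_circlePt

lemma integrable_norm_sq_aeval (η : Measure ℝ) [IsFiniteMeasure η] (f : ℝ[X]) :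
    Integrable (fun x => ‖aeval (circlePt x) f‖ ^ 2) η := by
  have h : Integrable (fun x => ∑ i ∈ Finset.range (f.natDegree + 1),
        f.coeff i * (aeval (circlePt x) f * circlePt x ^ (-(i : ℤ))).re) η :=
    integrable_finsetSum _ fun i _ => (integrable_aeval_mul_zpow η f i).const_mul _
  refine h.congr (ae_of_all _ fun x => ?_)
  simp only
  rw [← mul_conj_aeval_re, Complex.mul_conj, Complex.ofReal_re, Complex.normSq_eq_norm_sq]

/-- Every probability measure has Verblunsky coefficients in `[-1, 1]`. -/
lemma exists_trigMoment_eq (η : Measure ℝ) [IsProbabilityMeasure η] (N : ℕ) :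
    ∃ a : ℕ → ℝ, (∀ j, |a j| ≤ 1) ∧ ∀ k ≤ N, trigInt η k = trigMoment a k := by
  induction N with
  | zero =>
    refine ⟨0, by simp, fun k hk => ?_⟩
    obtain rfl : k = 0 := by omega
    simpa using trigInt_zero η
  | succ N ih =>
    obtain ⟨a, ha, h⟩ := ih
    have h0 := (toeplitz_szego_zero_iff (trigInt_zero η) N).2 h
    have hn := integral_norm_sq_szego h le_rfl
    have hnn : 0 ≤ szegoNorm a N := hn ▸ integral_nonneg fun x => by positivity
    have hsum : toeplitz (trigInt η) (-1) (szego a N) =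
        trigInt η (N + 1 : ℕ) +
          ∑ i ∈ Finset.range N, (szego a N).coeff i * trigMoment a (i + 1) := by
      rw [toeplitz_neg_one_szego]
      push_cast
      congr 1
      refine Finset.sum_congr rfl fun i hi => ?_
      have := h (i + 1) (by have := Finset.mem_range.1 hi; omega)
      push_cast at this
      rw [this]
    -- If the norm is zero, Φ_N vanishes η-almost everywhere; the next moment is then forced, and
    -- the recursion holds for any value of a_N. Otherwise the recursion is solved for a_N.
    obtain hE | hE := hnn.eq_or_lt
    · refine ⟨a, ha, fun k hk => ?_⟩
      obtain hk | rfl := Nat.le_succ_iff.1 hk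
      · exact h k hk
      rw [← hE] at hn
      have hz := (integral_eq_zero_iff_of_nonneg (fun x => by positivity)
        (integrable_norm_sq_aeval η _)).1 hn
      have : toeplitz (trigInt η) (-1) (szego a N) = 0 := by
        rw [toeplitz_trigInt]
        refine integral_eq_zero_of_ae ?_
        filter_upwards [hz] with x hx
        have : aeval (circlePt x) (szego a N) = 0 := by simpa using hx
        simp [this]
      rw [Nat.succ_eq_add_one, trigMoment_succ, ← hE]
      linarith
    · set c := toeplitz (trigInt η) (-1) (szego a N) / szegoNorm a N with hc
      set b := Function.update a N c with hb
      have hab : ∀ j < N, a j = b j := fun j hj => by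
        rw [hb, Function.update_of_ne (by omega)]
      have hbN : b N = c := by simp [hb]
      have h' : ∀ k ≤ N + 1, trigInt η k = trigMoment b k := by
        intro k hk
        obtain hk | rfl := Nat.le_succ_iff.1 hk
        · rw [h k hk, trigMoment_congr fun j hj => hab j (by omega)]
        · have hs : ∑ i ∈ Finset.range N, (szego a N).coeff i * trigMoment a (i + 1) =
              ∑ i ∈ Finset.range N, (szego a N).coeff i * trigMoment b (i + 1) :=
            Finset.sum_congr rfl fun i hi => by
              rw [trigMoment_congr fun j hj => hab j (by have := Finset.mem_range.1 hi; omega)]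
          rw [Nat.succ_eq_add_one, trigMoment_succ, ← szego_congr hab, ← szegoNorm_congr hab, ← hs,
            hbN, hc, div_mul_cancel₀ _ hE.ne', hsum]
          ring
      refine ⟨b, fun j => ?_, h'⟩
      obtain rfl | hj := eq_or_ne j N
      -- The next squared norm is the present positive one times 1 - c². Being the integral of a
      -- square it is nonnegative, which forces |c| ≤ 1.
      · have h1 := integral_norm_sq_szego h' le_rfl
        have h2 : 0 ≤ szegoNorm b (j + 1) := h1 ▸ integral_nonneg fun x => by positivity
        rw [szegoNorm_succ, ← szegoNorm_congr hab] at h2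
        have h3 := nonneg_of_mul_nonneg_right h2 hE
        exact (sq_le_one_iff_abs_le_one _).1 (by linarith)
      · rw [hb, Function.update_of_ne hj]
        exact ha j

end RandomOrthPoly
end

noncomputable section

open Polynomial

namespace RandomOrthPoly

variable {a : ℕ → ℝ}

/-! ### The Bernstein–Szegő measure -/

/-- With v = Φ*_k(z) and w = zΦ_k(z), the identity |v - aw|² - |w - av|² = (1 - a²)(|v|² - |w|²)
propagates the bound. Absence of zeros of Φ*_N in the closed disk makes the Bernstein–Szegő density
continuous and 1/Φ*_N holomorphic. -/
lemma norm_szego_le {N : ℕ} (ha : ∀ j < N, |a j| < 1) {z : ℂ} (hz : ‖z‖ ≤ 1) {k : ℕ}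
    (hk : k ≤ N) : ‖aeval z (szego a k)‖ ≤ ‖aeval z (szegoRev a k)‖ ∧
      aeval z (szegoRev a k) ≠ 0 := by
  induction k with
  | zero => simp
  | succ k ih =>
    obtain ⟨h1, h2⟩ := ih (by omega)
    have hak := ha k (by omega)
    rw [szego_succ, szegoRev_succ]
    simp only [map_sub, map_mul, aeval_X, aeval_C, Complex.coe_algebraMap]
    set v := aeval z (szegoRev a k)
    set w := z * aeval z (szego a k) with hw
    have hwv : ‖w‖ ≤ ‖v‖ := by
      rw [hw, norm_mul]
      calc _ ≤ 1 * ‖v‖ := by gcongr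
        _ = _ := one_mul _
    have hv : 0 < ‖v‖ := norm_pos_iff.2 h2
    clear_value w
    constructor
    · refine le_of_sq_le_sq ?_ (norm_nonneg _)
      rw [← Complex.normSq_eq_norm_sq, ← Complex.normSq_eq_norm_sq, Complex.normSq_sub,
        Complex.normSq_sub]
      have e1 : (w * (starRingEnd ℂ) (a k * v)).re = (v * (starRingEnd ℂ) (a k * w)).re := by
        simp; ring
      rw [e1, Complex.normSq_mul, Complex.normSq_mul, Complex.normSq_ofReal,
        Complex.normSq_eq_norm_sq, Complex.normSq_eq_norm_sq]
      have h3 : ‖w‖ ^ 2 ≤ ‖v‖ ^ 2 := by gcongr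
      have h4 := (sq_lt_one_iff_abs_lt_one (a k)).2 hak
      nlinarith
    · intro h
      have h3 : ‖v‖ = ‖(a k : ℂ) * w‖ := by rw [sub_eq_zero.1 h]
      rw [norm_mul, Complex.norm_real, Real.norm_eq_abs] at h3
      nlinarith [abs_nonneg (a k), norm_nonneg w]

lemma aeval_szegoRev_eq {z : ℂ} (hz : ‖z‖ = 1) (a : ℕ → ℝ) (k : ℕ) :
    aeval z (szegoRev a k) = z ^ k * (starRingEnd ℂ) (aeval z (szego a k)) ∧
    aeval z (szego a k) = z ^ k * (starRingEnd ℂ) (aeval z (szegoRev a k)) := by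
  have hzz : z * (starRingEnd ℂ) z = 1 := by
    rw [Complex.mul_conj, Complex.normSq_eq_norm_sq, hz]; simp
  induction k with
  | zero => simp
  | succ k ih =>
    obtain ⟨h1, h2⟩ := ih
    rw [szego_succ, szegoRev_succ]
    simp only [map_sub, map_mul, aeval_X, aeval_C, Complex.coe_algebraMap, Complex.conj_ofReal]
    constructor
    · rw [pow_succ]
      nth_rw 1 [h1]
      nth_rw 2 [h2]
      linear_combination (-z ^ k * (starRingEnd ℂ) (aeval z (szego a k))) * hzz
    · rw [pow_succ]
      nth_rw 1 [h2]
      nth_rw 2 [h1]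
      linear_combination (a k * z ^ k * (starRingEnd ℂ) (aeval z (szego a k))) * hzz

lemma szegoRev_eval_zero (a : ℕ → ℝ) (k : ℕ) : aeval (0 : ℂ) (szegoRev a k) = 1 := by
  induction k with
  | zero => simp
  | succ k ih => rw [szegoRev_succ]; simp [ih]

/-- Orthogonality of a Szegő polynomial implies orthogonality of all its predecessors. -/
lemma toeplitz_szego_eq_zero_of_top {τ : ℤ → ℝ} (hτ : ∀ j, τ (-j) = τ j) {N : ℕ}
    (ha : ∀ j < N, |a j| < 1)
    (h : ∀ j : ℤ, 0 ≤ j → j < N → toeplitz τ j (szego a N) = 0) {k : ℕ} (hk : k ≤ N) :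
    ∀ j : ℤ, 0 ≤ j → j < k → toeplitz τ j (szego a k) = 0 := by
  induction hk using Nat.decreasingInduction with
  | self => exact h
  | of_succ k hk ih =>
    intro j hj hjk
    have h1 := ih (j + 1) (by omega) (by push_cast; omega)
    have h2 := ih (k - j) (by omega) (by push_cast; omega)
    have h3 : toeplitz τ (j + 1) (szegoRev a (k + 1)) = 0 := by
      rw [toeplitz_szegoRev a hτ, ← h2]
      congr 1
      push_cast; ring_nf
    rw [toeplitz_szego_succ] at h1
    rw [toeplitz_szegoRev_succ] at h3
    have hak := (sq_lt_one_iff_abs_lt_one (a k)).2 (ha k (by omega))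
    -- The recursion inverted: (1 - a_k²) zΦ_k = Φ_{k+1} + a_k Φ*_{k+1}.
    have h4 : (1 - a k ^ 2) * toeplitz τ j (szego a k) = 0 := by
      rw [add_sub_cancel_right] at h1 h3
      linear_combination h1 + a k * h3
    exact (mul_eq_zero.1 h4).resolve_left (by linarith)

/-- The density of the Bernstein–Szegő measure on the circle, up to normalization. -/
def bsDensity (a : ℕ → ℝ) (N : ℕ) (φ : ℝ) : ℝ :=
  (2 * Real.pi)⁻¹ * (‖aeval (Complex.exp (φ * Complex.I)) (szego a N)‖ ^ 2)⁻¹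

/-- The image on `[0,1]` of the Bernstein–Szegő measure, not normalized. -/
def bsMeasure (a : ℕ → ℝ) (N : ℕ) : Measure ℝ :=
  ((volume.restrict (Set.Ioc 0 (2 * Real.pi))).withDensity
    fun φ => ENNReal.ofReal (bsDensity a N φ)).map fun φ => (1 + Real.cos φ) / 2

lemma bsDensity_nonneg (N : ℕ) (φ : ℝ) : 0 ≤ bsDensity a N φ := by
  unfold bsDensity; positivity

lemma continuous_bsDensity {N : ℕ} (ha : ∀ j < N, |a j| < 1) : Continuous (bsDensity a N) := by
  unfold bsDensity
  refine continuous_const.mul (Continuous.inv₀ ?_ fun φ => ?_)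
  · refine Continuous.pow (Continuous.norm ?_) 2
    exact (Polynomial.continuous_aeval _).comp (by fun_prop)
  · have hz : ‖Complex.exp (φ * Complex.I)‖ = 1 := Complex.norm_exp_ofReal_mul_I φ
    have := (norm_szego_le ha hz.le le_rfl).2
    rw [(aeval_szegoRev_eq hz a N).1] at this
    have h2 := right_ne_zero_of_mul this
    simpa using h2

lemma isFiniteMeasure_bsMeasure {N : ℕ} (ha : ∀ j < N, |a j| < 1) :
    IsFiniteMeasure (bsMeasure a N) := by
  have : IsFiniteMeasure ((volume.restrict (Set.Ioc 0 (2 * Real.pi))).withDensity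
      fun φ => ENNReal.ofReal (bsDensity a N φ)) := by
    refine isFiniteMeasure_withDensity_ofReal ?_
    exact ((continuous_bsDensity ha).integrableOn_Icc.mono_set Set.Ioc_subset_Icc_self).2
  unfold bsMeasure
  infer_instance

/-- For φ outside [0, π] the angle of the projected point is not φ itself, but both sides are
T_n(cos φ). The full circle can therefore be folded onto [0,1]. -/
lemma cos_int_mul_angle (φ : ℝ) (n : ℤ) :
    Real.cos (n * angle ((1 + Real.cos φ) / 2)) = Real.cos (n * φ) := by
  rw [← Polynomial.Chebyshev.T_real_cos, ← Polynomial.Chebyshev.T_real_cos, angle]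
  have : 2 * ((1 + Real.cos φ) / 2) - 1 = Real.cos φ := by ring
  rw [this, Real.cos_arccos (Real.neg_one_le_cos φ) (Real.cos_le_one φ)]

lemma toeplitz_bsMeasure {N : ℕ} (ha : ∀ j < N, |a j| < 1) (j : ℤ) (f : ℝ[X]) :
    toeplitz (trigInt (bsMeasure a N)) j f = ∫ φ in Set.Ioc 0 (2 * Real.pi), bsDensity a N φ *
      (aeval (Complex.exp (φ * Complex.I)) f * Complex.exp (φ * Complex.I) ^ (-j)).re := by
  have := isFiniteMeasure_bsMeasure ha
  rw [toeplitz_trigInt, bsMeasure, integral_map (by fun_prop),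
    integral_withDensity_eq_integral_toReal_smul]
  · refine integral_congr_ae (ae_of_all _ fun φ => ?_)
    simp only
    rw [ENNReal.toReal_ofReal (bsDensity_nonneg _ _), smul_eq_mul, aeval_mul_zpow_re,
      aeval_exp_mul_zpow_re]
    simp_rw [cos_int_mul_angle]
  · exact (continuous_bsDensity ha).measurable.ennreal_ofReal
  · exact ae_of_all _ fun φ => ENNReal.ofReal_lt_top
  · have h1 := continuous_aeval_circlePt f
    refine Measurable.aestronglyMeasurable ?_
    exact Complex.measurable_re.comp (h1.measurable.mul (continuous_circlePt.measurable.pow_const _))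

/-- On the circle Φ_N z^{-j} / |Φ_N|² = z^{N-j} / Φ*_N, which is holomorphic on the closed disk. The
mean value property evaluates its average at 0, where Φ*_N = 1. -/
lemma toeplitz_bsMeasure_szego {N : ℕ} (ha : ∀ j < N, |a j| < 1) (j : ℕ) (hj : j ≤ N) :
    toeplitz (trigInt (bsMeasure a N)) j (szego a N) = if j = N then 1 else 0 := by
  set G : ℂ → ℂ := fun z => z ^ (N - j) / aeval z (szegoRev a N) with hG
  have hG' : DiffContOnCl ℂ G (Metric.ball 0 |1|) := by
    refine DifferentiableOn.diffContOnCl fun z hz => ?_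
    rw [abs_one, closure_ball _ one_ne_zero] at hz
    refine DifferentiableAt.differentiableWithinAt ?_
    refine DifferentiableAt.div (by fun_prop) (Polynomial.differentiableAt_aeval _) ?_
    exact (norm_szego_le ha (by simpa using hz) le_rfl).2
  have hav := hG'.circleAverage
  have hint : IntervalIntegrable (fun φ => G (circleMap 0 1 φ)) volume 0 (2 * Real.pi) := by
    refine Continuous.intervalIntegrable ?_ _ _
    refine continuous_iff_continuousAt.2 fun φ => ?_
    refine ContinuousAt.div (by fun_prop) ?_ ?_
    · exact ((Polynomial.continuous_aeval _).comp (continuous_circleMap 0 1)).continuousAt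
    · exact (norm_szego_le ha (by simp) le_rfl).2
  rw [toeplitz_bsMeasure ha]
  have hpt : ∀ φ : ℝ, bsDensity a N φ * (aeval (Complex.exp (φ * Complex.I)) (szego a N) *
      Complex.exp (φ * Complex.I) ^ (-(j : ℤ))).re =
        (2 * Real.pi)⁻¹ * (G (circleMap 0 1 φ)).re := by
    intro φ
    have hz : ‖Complex.exp (φ * Complex.I)‖ = 1 := Complex.norm_exp_ofReal_mul_I φ
    have hc : circleMap 0 1 φ = Complex.exp (φ * Complex.I) := by simp [circleMap]
    rw [hc, hG, bsDensity]
    set z := Complex.exp (φ * Complex.I)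
    have hz0 : z ≠ 0 := Complex.exp_ne_zero _
    have hne := (norm_szego_le ha hz.le le_rfl).2
    have hrev := (aeval_szegoRev_eq hz a N).1
    rw [hrev] at hne
    simp only
    rw [hrev, mul_assoc, ← Complex.normSq_eq_norm_sq, ← Complex.re_ofReal_mul]
    congr 2
    have hu := right_ne_zero_of_mul hne
    set u := aeval z (szego a N)
    have hu0 : u ≠ 0 := by simpa using hu
    rw [Complex.ofReal_inv, Complex.normSq_eq_conj_mul_self, zpow_neg, zpow_natCast]
    have : z ^ N = z ^ (N - j) * z ^ j := by rw [← pow_add, Nat.sub_add_cancel hj]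
    rw [this]
    field_simp
  simp_rw [hpt]
  rw [integral_const_mul, ← intervalIntegral.integral_of_le (by positivity)]
  have hre : ∫ φ in (0 : ℝ)..2 * Real.pi, (G (circleMap 0 1 φ)).re =
      (∫ φ in (0 : ℝ)..2 * Real.pi, G (circleMap 0 1 φ)).re :=
    Complex.reCLM.intervalIntegral_comp_comm hint
  rw [hre, ← Complex.re_ofReal_mul]
  have hav2 : ((2 * Real.pi : ℝ)⁻¹ : ℝ) * (∫ φ in (0 : ℝ)..2 * Real.pi, G (circleMap 0 1 φ)) =
      G 0 := by
    rw [← hav, Real.circleAverage_def, Complex.real_smul]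
  rw [hav2, hG]
  simp only [szegoRev_eval_zero, div_one]
  split_ifs with h
  · simp [h]
  · rw [zero_pow (by omega)]; simp

/-- Every vector of Verblunsky coefficients in `(-1, 1)` comes from a measure on `[0,1]`. -/
lemma exists_measure_trigInt_eq {N : ℕ} (ha : ∀ j < N, |a j| < 1) :
    ∃ η : Measure ℝ, IsProbabilityMeasure η ∧ η (Set.Icc (0 : ℝ) 1)ᶜ = 0 ∧
      ∀ k ≤ N, trigInt η k = trigMoment a k := by
  have hfin := isFiniteMeasure_bsMeasure ha
  have hE := szegoNorm_pos ha
  set η₀ := bsMeasure a N with hη₀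
  have hvan : ∀ k ≤ N, ∀ j : ℤ, 0 ≤ j → j < k → toeplitz (trigInt η₀) j (szego a k) = 0 := by
    intro k hk
    refine toeplitz_szego_eq_zero_of_top (trigInt_neg _) ha (fun j hj hjN => ?_) hk
    lift j to ℕ using hj
    rw [toeplitz_bsMeasure_szego ha j (by omega), if_neg (by omega)]
  have h0 : ∀ k, 1 ≤ k → k ≤ N → toeplitz (trigInt η₀) 0 (szego a k) = 0 :=
    fun k hk hkN => hvan k hkN 0 le_rfl (by omega)
  -- The pairing of Φ_N with z^N is the Szegő norm times the total mass, and it is also 1 by the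
  -- mean value property. This fixes the normalization.
  have hmass : szegoNorm a N * trigInt η₀ 0 = 1 := by
    rw [← toeplitz_szego_self (trigInt_neg _) h0 le_rfl, toeplitz_bsMeasure_szego ha N le_rfl]
    simp
  set η : Measure ℝ := ENNReal.ofReal (szegoNorm a N) • η₀ with hη
  have htrig : ∀ j, trigInt η j = szegoNorm a N * trigInt η₀ j := by
    intro j
    rw [trigInt, hη, integral_smul_measure, ENNReal.toReal_ofReal hE.le, smul_eq_mul, trigInt]
  have htoep : ∀ j f, toeplitz (trigInt η) j f = szegoNorm a N * toeplitz (trigInt η₀) j f := by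
    intro j f
    rw [toeplitz_eq_sum _ _ (Nat.lt_succ_self _), toeplitz_eq_sum _ _ (Nat.lt_succ_self _),
      Finset.mul_sum]
    exact Finset.sum_congr rfl fun i _ => by rw [htrig, mul_assoc]
  have hprob : IsProbabilityMeasure η := by
    refine ⟨?_⟩
    have : η₀.real Set.univ = trigInt η₀ 0 := by simp [trigInt]
    rw [hη, Measure.smul_apply, smul_eq_mul, ← ofReal_measureReal, this,
      ← ENNReal.ofReal_mul hE.le, hmass, ENNReal.ofReal_one]
  refine ⟨η, hprob, ?_, ?_⟩
  · rw [hη, Measure.smul_apply, hη₀, bsMeasure, Measure.map_apply (by fun_prop)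
      measurableSet_Icc.compl]
    have : (fun φ => (1 + Real.cos φ) / 2) ⁻¹' (Set.Icc (0 : ℝ) 1)ᶜ = ∅ := by
      ext φ
      have := Real.neg_one_le_cos φ
      have := Real.cos_le_one φ
      simp only [Set.mem_preimage, Set.mem_compl_iff, Set.mem_Icc, Set.mem_empty_iff_false,
        iff_false, not_not]
      constructor <;> linarith
    rw [this]; simp
  · refine (toeplitz_szego_zero_iff (trigInt_zero η) N).1 fun k hk hkN => ?_
    rw [htoep, h0 k hk hkN, mul_zero]

/-! ### Ordinary moments -/

/-- The moment of order `k` of a measure on `[0,1]` with trigonometric moments `τ`. -/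
def momentOf (τ : ℤ → ℝ) (k : ℕ) : ℝ := (4 ^ k)⁻¹ * toeplitz τ k ((1 + X) ^ (2 * k))

/-- In the form x = (1 + z)² / (4z) this turns polynomials in x into Laurent polynomials in z. -/
lemma one_add_circlePt_sq {x : ℝ} (hx : x ∈ Set.Icc (0 : ℝ) 1) :
    (1 + circlePt x) ^ 2 = 4 * x * circlePt x := by
  have h1 : circlePt x = (2 * x - 1 : ℝ) + Real.sin (angle x) * Complex.I := by
    rw [circlePt, Complex.exp_mul_I, ← Complex.ofReal_cos, ← Complex.ofReal_sin, angle,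
      Real.cos_arccos (by linarith [hx.1]) (by linarith [hx.2])]
  have h2 : Real.sin (angle x) ^ 2 = 1 - (2 * x - 1) ^ 2 := by
    rw [Real.sin_sq, angle, Real.cos_arccos (by linarith [hx.1]) (by linarith [hx.2])]
  have h3 : (Real.sin (angle x) : ℂ) ^ 2 = 1 - (2 * x - 1) ^ 2 := by exact_mod_cast h2
  rw [h1]
  push_cast at h3 ⊢
  linear_combination (Complex.I ^ 2) * h3 + (1 - (2 * (x : ℂ) - 1) ^ 2) * Complex.I_sq

lemma integral_pow_eq_momentOf {η : Measure ℝ} [IsProbabilityMeasure η]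
    (hη : η (Set.Icc (0 : ℝ) 1)ᶜ = 0) (k : ℕ) : ∫ x, x ^ k ∂η = momentOf (trigInt η) k := by
  rw [momentOf, toeplitz_trigInt, ← integral_const_mul]
  refine integral_congr_ae ?_
  have : ∀ᵐ x ∂η, x ∈ Set.Icc (0 : ℝ) 1 := hη
  filter_upwards [this] with x hx
  have hz := circlePt_ne_zero x
  simp only [map_pow, map_add, map_one, aeval_X]
  rw [pow_mul, one_add_circlePt_sq hx, mul_pow, mul_assoc, zpow_neg, zpow_natCast,
    mul_inv_cancel₀ (pow_ne_zero _ hz), mul_one]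
  have : ((4 * x : ℂ) ^ k).re = (4 * x) ^ k := by
    rw [← Complex.ofReal_re ((4 * x) ^ k)]; push_cast; rfl
  rw [this, mul_pow, inv_mul_cancel_left₀ (by positivity)]

lemma natDegree_one_add_X_pow (k : ℕ) : ((1 + X : ℝ[X]) ^ k).natDegree = k := by
  rw [natDegree_pow, add_comm, ← C_1, natDegree_X_add_C, mul_one]

lemma momentOf_eq_sum (τ : ℤ → ℝ) (k : ℕ) : momentOf τ k =
    (4 ^ k)⁻¹ * ∑ i ∈ Finset.range (2 * k + 1), τ (i - k) * (2 * k).choose i := by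
  rw [momentOf, toeplitz_eq_sum (n := 2 * k + 1) _ _ (by rw [natDegree_one_add_X_pow]; omega)]
  simp [coeff_one_add_X_pow]

/-- The moment of order `k + 1` is affine in the trigonometric moment of the same order. -/
lemma momentOf_succ {τ : ℤ → ℝ} (hτ : ∀ j, τ (-j) = τ j) (k : ℕ) : momentOf τ (k + 1) =
    (4 ^ (k + 1))⁻¹ * (2 * τ (k + 1) +
      ∑ i ∈ Finset.range (2 * k + 1), τ (i - k) * (2 * (k + 1)).choose (i + 1)) := by
  rw [momentOf_eq_sum, Finset.sum_range_succ, show 2 * (k + 1) = (2 * k + 1) + 1 by ring,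
    Finset.sum_range_succ']
  have h1 : ∀ i : ℕ, ((i + 1 : ℕ) : ℤ) - (k + 1 : ℕ) = i - k := fun i => by push_cast; ring
  -- By evenness the first and the last term of the sum agree, whence the factor 2.
  have h2 : τ ((0 : ℕ) - (k + 1 : ℕ)) = τ (k + 1) := by
    rw [← hτ]; push_cast; ring_nf
  have h3 : ((2 * k + 1 : ℕ) : ℤ) - k = k + 1 := by push_cast; ring
  simp only [h1, h2, h3, Nat.choose_self, Nat.choose_zero_right, Nat.cast_one]
  ring

lemma momentOf_congr {τ τ' : ℤ → ℝ} (hτ : ∀ j, τ (-j) = τ j) (hτ' : ∀ j, τ' (-j) = τ' j)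
    {k : ℕ} (h : ∀ j ≤ k, τ j = τ' j) : momentOf τ k = momentOf τ' k := by
  rw [momentOf_eq_sum, momentOf_eq_sum]
  congr 1
  refine Finset.sum_congr rfl fun i hi => ?_
  have hi := Finset.mem_range.1 hi
  congr 1
  obtain hik | hik := le_total k i
  · have := h (i - k) (by omega)
    rwa [Nat.cast_sub hik] at this
  · have := h (k - i) (by omega)
    rw [Nat.cast_sub hik, ← hτ, ← hτ', neg_sub] at this
    exact this

lemma eq_of_momentOf_eq {τ τ' : ℤ → ℝ} (hτ : ∀ j, τ (-j) = τ j) (hτ' : ∀ j, τ' (-j) = τ' j)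
    (h0 : τ 0 = τ' 0) {N : ℕ} (h : ∀ k < N, momentOf τ (k + 1) = momentOf τ' (k + 1)) :
    ∀ k ≤ N, τ k = τ' k := by
  intro k
  induction k using Nat.strong_induction_on with
  | _ k ih =>
    intro hk
    cases k with
    | zero => simpa using h0
    | succ k =>
      have h1 := h k (by omega)
      rw [momentOf_succ hτ, momentOf_succ hτ'] at h1
      have h2 : ∑ i ∈ Finset.range (2 * k + 1), τ (i - k) * (2 * (k + 1)).choose (i + 1) =
          ∑ i ∈ Finset.range (2 * k + 1), τ' (i - k) * (2 * (k + 1)).choose (i + 1) := by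
        refine Finset.sum_congr rfl fun i hi => ?_
        have hi := Finset.mem_range.1 hi
        congr 1
        obtain hik | hik := le_total k i
        · have := ih (i - k) (by omega) (by omega)
          rwa [Nat.cast_sub hik] at this
        · have := ih (k - i) (by omega) (by omega)
          rw [Nat.cast_sub hik, ← hτ, ← hτ', neg_sub] at this
          exact this
      rw [h2] at h1
      have h3 := mul_left_cancel₀ (by positivity) h1
      push_cast
      linarith

/-! ### Positivity on polynomials of low degree -/

/-- On the circle z^d R(x) is a polynomial F(z) of degree at most 2d with top coefficient R_d / 4^d.
Its pairing with Φ_{2d} is that coefficient times a positive norm, so R_d = 0 if R vanishes almost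
everywhere. This nondegeneracy serves both for the Hankel determinant and for the reality of the
roots. -/
lemma eq_zero_of_ae_eval_eq_zero {η : Measure ℝ} [IsProbabilityMeasure η]
    (hη : η (Set.Icc (0 : ℝ) 1)ᶜ = 0) {N : ℕ} (ha : ∀ j < N, |a j| < 1)
    (h : ∀ k ≤ N, trigInt η k = trigMoment a k) {R : ℝ[X]} (hR : 2 * R.natDegree ≤ N)
    (hae : ∀ᵐ x ∂η, R.eval x = 0) : R = 0 := by
  set d := R.natDegree with hd
  set F : ℝ[X] := ∑ i ∈ Finset.range (d + 1),
    C (R.coeff i / 4 ^ i) * (X ^ (d - i) * (1 + X) ^ (2 * i)) with hF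
  have hdeg : ∀ i ≤ d, (C (R.coeff i / 4 ^ i) * (X ^ (d - i) * (1 + X : ℝ[X]) ^ (2 * i))).natDegree
      ≤ d + i := by
    intro i hi
    refine (natDegree_C_mul_le _ _).trans (natDegree_mul_le.trans ?_)
    rw [natDegree_X_pow, natDegree_one_add_X_pow]; omega
  have hFd : F.natDegree ≤ 2 * d := by
    refine natDegree_sum_le_of_forall_le _ _ fun i hi => ?_
    have := Finset.mem_range.1 hi
    exact (hdeg i (by omega)).trans (by omega)
  have hFc : F.coeff (2 * d) = R.coeff d / 4 ^ d := by
    rw [hF, finsetSum_coeff, Finset.sum_range_succ, Finset.sum_eq_zero, zero_add]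
    · have : (1 + X : ℝ[X]).coeff 1 = 1 := by simp [coeff_one]
      simp [coeff_one_add_X_pow]
    · intro i hi
      have := Finset.mem_range.1 hi
      exact coeff_eq_zero_of_natDegree_lt ((hdeg i (by omega)).trans_lt (by omega))
  have hFz : ∀ᵐ x ∂η, aeval (circlePt x) F = 0 := by
    have : ∀ᵐ x ∂η, x ∈ Set.Icc (0 : ℝ) 1 := hη
    filter_upwards [this, hae] with x hx h0
    have hterm : ∀ i ∈ Finset.range (d + 1), aeval (circlePt x)
        (C (R.coeff i / 4 ^ i) * (X ^ (d - i) * (1 + X : ℝ[X]) ^ (2 * i))) =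
          circlePt x ^ d * ((R.coeff i : ℂ) * x ^ i) := by
      intro i hi
      have := Finset.mem_range.1 hi
      simp only [map_mul, map_pow, map_add, map_one, aeval_X, aeval_C, Complex.coe_algebraMap]
      rw [pow_mul, one_add_circlePt_sq hx, mul_pow, mul_pow]
      have hs : circlePt x ^ d = circlePt x ^ (d - i) * circlePt x ^ i := by
        rw [← pow_add, Nat.sub_add_cancel (by omega)]
      rw [hs]
      push_cast
      field_simp
    rw [hF, map_sum, Finset.sum_congr rfl hterm, ← Finset.mul_sum]
    have : ∑ i ∈ Finset.range (d + 1), (R.coeff i : ℂ) * x ^ i = (R.eval x : ℝ) := by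
      rw [eval_eq_sum_range]; push_cast; rfl
    rw [this, h0]; simp
  have key := integral_mul_conj_szego h hR hFd
  rw [integral_eq_zero_of_ae, hFc] at key
  · have hE := szegoNorm_pos fun j hj => ha j (lt_of_lt_of_le hj hR)
    have : R.coeff d = 0 := by
      have h4 : (4 : ℝ) ^ d ≠ 0 := by positivity
      field_simp at key
      simpa [hE.ne'] using key.symm
    exact leadingCoeff_eq_zero.1 this
  · filter_upwards [hFz] with x hx
    simp [hx]

end RandomOrthPoly
end

noncomputable section

open Polynomial

namespace RandomOrthPoly

/-! ### The moment vector as a function of the Verblunsky coefficients -/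

/-- Extension of a finite vector by zero. -/
def extend {N : ℕ} (α : Fin N → ℝ) (k : ℕ) : ℝ := if h : k < N then α ⟨k, h⟩ else 0

/-- The trigonometric moments of both signs. -/
def trigExt (a : ℕ → ℝ) (j : ℤ) : ℝ := trigMoment a j.natAbs

/-- The moment vector with given Verblunsky coefficients. -/
def momentMap (N : ℕ) (α : Fin N → ℝ) (i : Fin N) : ℝ := momentOf (trigExt (extend α)) (i + 1)

/-- The open cube of Verblunsky coefficients. -/
def openCube (N : ℕ) : Set (Fin N → ℝ) := Set.univ.pi fun _ => Set.Ioo (-1) 1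

lemma extend_of_lt {N : ℕ} (α : Fin N → ℝ) {k : ℕ} (h : k < N) : extend α k = α ⟨k, h⟩ :=
  dif_pos h

lemma extend_fin {N : ℕ} (α : Fin N → ℝ) (k : Fin N) : extend α k = α k :=
  extend_of_lt α k.2

lemma trigExt_neg (a : ℕ → ℝ) (j : ℤ) : trigExt a (-j) = trigExt a j := by simp [trigExt]

lemma trigExt_natCast (a : ℕ → ℝ) (j : ℕ) : trigExt a j = trigMoment a j := by simp [trigExt]

lemma trigExt_succ (a : ℕ → ℝ) (j : ℕ) : trigExt a (j + 1) = trigMoment a (j + 1) :=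
  trigExt_natCast a (j + 1)

lemma abs_extend_lt {N : ℕ} {α : Fin N → ℝ} (hα : α ∈ openCube N) : ∀ j < N, |extend α j| < 1 :=
  fun j hj => by
    rw [extend_of_lt α hj]
    exact abs_lt.2 (hα ⟨j, hj⟩ trivial)

lemma momentMap_eq_of_trigInt {N : ℕ} {η : Measure ℝ} [IsProbabilityMeasure η]
    (hη : η (Set.Icc (0 : ℝ) 1)ᶜ = 0) {α : Fin N → ℝ}
    (h : ∀ k ≤ N, trigInt η k = trigMoment (extend α) k) (i : Fin N) :
    momentMap N α i = ∫ x, x ^ ((i : ℕ) + 1) ∂η := by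
  rw [integral_pow_eq_momentOf hη]
  refine momentOf_congr (trigExt_neg _) (trigInt_neg η) fun j hj => ?_
  rw [trigExt_natCast, h j (by omega)]

lemma exists_measure_momentMap {N : ℕ} {α : Fin N → ℝ} (hα : α ∈ openCube N) :
    ∃ η : Measure ℝ, IsProbabilityMeasure η ∧ η (Set.Icc (0 : ℝ) 1)ᶜ = 0 ∧
      (∀ k ≤ N, trigInt η k = trigMoment (extend α) k) ∧
      ∀ i : Fin N, momentMap N α i = ∫ x, x ^ ((i : ℕ) + 1) ∂η := by
  obtain ⟨η, h1, h2, h3⟩ := exists_measure_trigInt_eq (abs_extend_lt hα)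
  exact ⟨η, h1, h2, h3, momentMap_eq_of_trigInt h2 h3⟩

lemma image_openCube_subset (N : ℕ) : momentMap N '' openCube N ⊆ momentSpace N := by
  rintro _ ⟨α, hα, rfl⟩
  obtain ⟨η, h1, h2, _, h4⟩ := exists_measure_momentMap hα
  exact ⟨η, h1, h2, h4⟩

lemma momentSpace_subset (N : ℕ) :
    momentSpace N ⊆ momentMap N '' Set.univ.pi fun _ => Set.Icc (-1) 1 := by
  rintro c ⟨η, hη, hs, hc⟩
  obtain ⟨a, ha, h⟩ := exists_trigMoment_eq η N
  refine ⟨fun i => a i, fun i _ => abs_le.1 (ha i), ?_⟩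
  ext i
  rw [hc i]
  refine momentMap_eq_of_trigInt hs (fun k hk => ?_) i
  rw [h k hk]
  refine trigMoment_congr fun j hj => ?_
  rw [extend_of_lt _ (by omega)]

/-- The moments determine the trigonometric moments, and a_k is then recovered recursively on
division by the Szegő norm of degree k, which is positive in the open cube. -/
lemma momentMap_injOn (N : ℕ) : Set.InjOn (momentMap N) (openCube N) := by
  intro α hα β hβ hab
  have h1 := eq_of_momentOf_eq (N := N) (trigExt_neg (extend α)) (trigExt_neg (extend β))
    (by simp [trigExt]) fun k hk => congr_fun hab ⟨k, hk⟩
  have h2 : ∀ k < N, extend α k = extend β k := by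
    intro k
    induction k using Nat.strong_induction_on with
    | _ k ih =>
      intro hk
      have h3 := h1 (k + 1) hk
      have hlt : ∀ j < k, extend α j = extend β j := fun j hj => ih j hj (by omega)
      rw [trigExt_natCast, trigExt_natCast, trigMoment_succ, trigMoment_succ,
        ← szego_congr hlt, ← szegoNorm_congr hlt] at h3
      have h4 : ∑ i ∈ Finset.range k, (szego (extend α) k).coeff i * trigMoment (extend α) (i + 1) =
          ∑ i ∈ Finset.range k, (szego (extend α) k).coeff i * trigMoment (extend β) (i + 1) := by
        refine Finset.sum_congr rfl fun i hi => ?_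
        have := Finset.mem_range.1 hi
        rw [trigMoment_congr fun j hj => hlt j (by omega)]
      rw [h4] at h3
      have hE := szegoNorm_pos fun j (hj : j < k) => abs_extend_lt hα j (by omega)
      exact mul_right_cancel₀ hE.ne' (by linarith)
  ext i
  simpa [extend_fin] using h2 i i.2

/-! ### Smoothness and the Jacobian -/

lemma contDiff_extend {N : ℕ} (k : ℕ) : ContDiff ℝ 1 fun α : Fin N → ℝ => extend α k := by
  unfold extend
  split_ifs with h <;> fun_prop

lemma contDiff_szego_coeff {N : ℕ} (k : ℕ) : ∀ i,
    ContDiff ℝ 1 (fun α : Fin N → ℝ => (szego (extend α) k).coeff i) ∧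
      ContDiff ℝ 1 (fun α : Fin N → ℝ => (szegoRev (extend α) k).coeff i) := by
  induction k with
  | zero => intro i; simp only [szego_zero, szegoRev_zero]; exact ⟨contDiff_const, contDiff_const⟩
  | succ k ih =>
    have hX : ∀ i, ContDiff ℝ 1 (fun α : Fin N → ℝ => (X * szego (extend α) k).coeff i) := by
      intro i
      cases i with
      | zero => simp only [coeff_X_mul_zero]; exact contDiff_const
      | succ i => simp only [coeff_X_mul]; exact (ih i).1
    intro i
    simp only [szego_succ, szegoRev_succ, coeff_sub, coeff_C_mul]
    exact ⟨(hX i).sub ((contDiff_extend k).mul (ih i).2),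
      (ih i).2.sub ((contDiff_extend k).mul (hX i))⟩

lemma contDiff_szegoNorm {N : ℕ} (k : ℕ) :
    ContDiff ℝ 1 fun α : Fin N → ℝ => szegoNorm (extend α) k := by
  unfold szegoNorm
  exact contDiff_prod fun j _ => contDiff_const.sub ((contDiff_extend j).pow 2)

lemma contDiff_trigMoment {N : ℕ} (k : ℕ) :
    ContDiff ℝ 1 fun α : Fin N → ℝ => trigMoment (extend α) k := by
  induction k using Nat.strong_induction_on with
  | _ k ih =>
    cases k with
    | zero => simp only [trigMoment_zero]; exact contDiff_const
    | succ k =>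
      rw [funext fun α : Fin N → ℝ => trigMoment_succ (extend α) k]
      refine ((contDiff_extend k).mul (contDiff_szegoNorm k)).sub (ContDiff.sum fun i hi => ?_)
      have := Finset.mem_range.1 hi
      exact (contDiff_szego_coeff k i).1.mul (ih (i + 1) (by omega))

lemma contDiff_momentMap (N : ℕ) : ContDiff ℝ 1 (momentMap N) := by
  refine contDiff_pi.2 fun i => ?_
  simp only [momentMap, momentOf_eq_sum]
  exact contDiff_const.mul (ContDiff.sum fun i _ => (contDiff_trigMoment _).mul contDiff_const)

lemma extend_add_single {N : ℕ} (α : Fin N → ℝ) (j : Fin N) (t : ℝ) (l : ℕ) :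
    extend (α + t • Pi.single j 1) l = extend α l + if l = j then t else 0 := by
  by_cases hl : l < N
  · rw [extend_of_lt _ hl, extend_of_lt _ hl]
    simp [Pi.single_apply, Fin.ext_iff]
  · have : l ≠ j := by omega
    simp [extend, hl, this]

/-- Varying a_j leaves the moments of order at most j fixed and moves the moment of order j+1
exactly linearly. The Jacobian entries on and above the diagonal are thus found without
differentiating the recursion. -/
lemma momentMap_add_single {N : ℕ} (α : Fin N → ℝ) {i j : Fin N} (hij : i ≤ j) (t : ℝ) :
    momentMap N (α + t • Pi.single j 1) i = momentMap N α i +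
      t * if i = j then 2 * (4 ^ ((i : ℕ) + 1))⁻¹ * szegoNorm (extend α) i else 0 := by
  set β := α + t • Pi.single j 1 with hβ
  have hlt : ∀ l < (i : ℕ), extend β l = extend α l := fun l hl => by
    have : l ≠ j := by have : (i : ℕ) ≤ j := hij; omega
    rw [hβ, extend_add_single, if_neg this, add_zero]
  have hmom : ∀ l ≤ (i : ℕ), trigMoment (extend β) l = trigMoment (extend α) l := fun l hl =>
    trigMoment_congr fun r hr => hlt r (by omega)
  have hi : extend β i = extend α i + if i = j then t else 0 := by
    rw [hβ, extend_add_single]; simp [Fin.ext_iff]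
  rw [momentMap, momentMap, momentOf_succ (trigExt_neg _), momentOf_succ (trigExt_neg _),
    trigExt_succ, trigExt_succ, trigMoment_succ, trigMoment_succ, szego_congr hlt,
    szegoNorm_congr hlt, hi]
  have h1 : ∑ r ∈ Finset.range i, (szego (extend α) i).coeff r * trigMoment (extend β) (r + 1) =
      ∑ r ∈ Finset.range i, (szego (extend α) i).coeff r * trigMoment (extend α) (r + 1) :=
    Finset.sum_congr rfl fun r hr => by
      rw [hmom _ (by have := Finset.mem_range.1 hr; omega)]
  have h2 : ∑ r ∈ Finset.range (2 * (i : ℕ) + 1), trigExt (extend β) (r - (i : ℕ)) *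
        (2 * ((i : ℕ) + 1)).choose (r + 1) =
      ∑ r ∈ Finset.range (2 * (i : ℕ) + 1), trigExt (extend α) (r - (i : ℕ)) *
        (2 * ((i : ℕ) + 1)).choose (r + 1) :=
    Finset.sum_congr rfl fun r hr => by
      rw [trigExt, hmom _ (by have := Finset.mem_range.1 hr; omega), trigExt]
  rw [h1, h2]
  split_ifs <;> ring

lemma prod_range_prod_range {M : Type*} [CommMonoid M] (f : ℕ → M) (N : ℕ) :
    ∏ i ∈ Finset.range N, ∏ j ∈ Finset.range i, f j =
      ∏ j ∈ Finset.range N, f j ^ (N - 1 - j) := by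
  induction N with
  | zero => simp
  | succ N ih =>
    rw [Finset.prod_range_succ, ih, ← Finset.prod_mul_distrib, Finset.prod_range_succ]
    simp only [add_tsub_cancel_right, tsub_self, pow_zero, mul_one]
    refine Finset.prod_congr rfl fun j hj => ?_
    have := Finset.mem_range.1 hj
    rw [← pow_succ]
    congr 1
    omega

/-- The constant in the Jacobian determinant of the moment map. -/
def jacConst (N : ℕ) : ℝ := ∏ i ∈ Finset.range N, 2 * (4 ^ (i + 1) : ℝ)⁻¹

/-- The matrix is lower triangular and its i-th diagonal entry contains ∏_{j<i} (1 - a_j²). A given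
factor 1 - a_j² occurs once for every i with j < i < N, that is N-1-j times. -/
lemma det_fderiv_momentMap (N : ℕ) (α : Fin N → ℝ) :
    (fderiv ℝ (momentMap N) α).det = jacConst N * ∏ j : Fin N, (1 - α j ^ 2) ^ (N - 1 - j) := by
  have hd : HasFDerivAt (momentMap N) (fderiv ℝ (momentMap N) α) α :=
    ((contDiff_momentMap N).differentiable one_ne_zero α).hasFDerivAt
  set L := fderiv ℝ (momentMap N) α with hL
  have hentry : ∀ i j : Fin N, i ≤ j → L (Pi.single j 1) i =
      if i = j then 2 * (4 ^ ((i : ℕ) + 1))⁻¹ * szegoNorm (extend α) i else 0 := by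
    intro i j hij
    have h1 : HasDerivAt (fun t : ℝ => momentMap N (α + t • Pi.single j 1)) (L (Pi.single j 1)) 0 :=
      hd.hasLineDerivAt _
    have h2 := (hasDerivAt_pi.1 h1) i
    simp_rw [momentMap_add_single α hij] at h2
    have h3 := ((hasDerivAt_id (0 : ℝ)).mul_const
      (if i = j then 2 * (4 ^ ((i : ℕ) + 1))⁻¹ * szegoNorm (extend α) i else 0)).const_add
        (momentMap N α i)
    rw [one_mul] at h3
    exact h2.unique h3
  have hdet : L.det = (LinearMap.toMatrix' (L : (Fin N → ℝ) →ₗ[ℝ] (Fin N → ℝ))).det := by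
    rw [LinearMap.det_toMatrix']
  rw [hdet, Matrix.det_of_isLowerTriangular]
  · have : ∀ i : Fin N, LinearMap.toMatrix' (L : (Fin N → ℝ) →ₗ[ℝ] (Fin N → ℝ)) i i =
        2 * (4 ^ ((i : ℕ) + 1))⁻¹ * szegoNorm (extend α) i := fun i => by
      simpa [LinearMap.toMatrix'_apply] using hentry i i le_rfl
    simp_rw [this]
    rw [Finset.prod_mul_distrib, jacConst, ← Finset.prod_range fun i => 2 * (4 ^ (i + 1) : ℝ)⁻¹,
      ← Finset.prod_range fun i => szegoNorm (extend α) i]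
    congr 1
    simp only [szegoNorm]
    rw [prod_range_prod_range, Finset.prod_range]
    simp_rw [extend_fin]
  · intro i j hij
    have hij' : i < j := by simpa using hij
    simpa [LinearMap.toMatrix'_apply, hij'.ne] using hentry i j hij'.le

lemma jacConst_pos (N : ℕ) : 0 < jacConst N := Finset.prod_pos fun _ _ => by positivity

end RandomOrthPoly
end

noncomputable section

namespace RandomOrthPoly

/-! ### Products of measures with densities -/

lemma pi_withDensity_ofReal {ι : Type*} [Fintype ι] {f : ι → ℝ → ℝ} (h0 : ∀ i x, 0 ≤ f i x)
    (hf : ∀ i, Integrable (f i)) :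
    Measure.pi (fun i => (volume : Measure ℝ).withDensity fun x => ENNReal.ofReal (f i x)) =
      (volume : Measure (ι → ℝ)).withDensity fun x => ENNReal.ofReal (∏ i, f i (x i)) := by
  have hfin : ∀ i, IsFiniteMeasure
      ((volume : Measure ℝ).withDensity fun x => ENNReal.ofReal (f i x)) :=
    fun i => isFiniteMeasure_withDensity_ofReal (hf i).2
  refine Measure.pi_eq fun s hs => ?_
  rw [withDensity_apply _ (MeasurableSet.univ_pi hs), volume_pi, Measure.restrict_pi_pi,
    ← ofReal_integral_eq_lintegral_ofReal, integral_fintype_prod_eq_prod,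
    ENNReal.ofReal_prod_of_nonneg]
  · refine Finset.prod_congr rfl fun i _ => ?_
    rw [withDensity_apply _ (hs i), ofReal_integral_eq_lintegral_ofReal (hf i).integrableOn]
    exact ae_of_all _ (h0 i)
  · exact fun i _ => integral_nonneg (h0 i)
  · exact Integrable.fintype_prod_dep fun i => (hf i).integrableOn
  · exact ae_of_all _ fun x => Finset.prod_nonneg fun i _ => h0 i _

/-! ### Symmetric beta distributions on `(-1, 1)` -/

/-- The weight `(1 - x²)^K` on `(-1, 1)`. -/
def betaWeight (K : ℕ) : ℝ → ℝ := (Set.Ioo (-1) 1).indicator fun x => (1 - x ^ 2) ^ K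

/-- The total mass of the weight. -/
def betaMass (K : ℕ) : ℝ := ∫ x, betaWeight K x

/-- The symmetric beta distribution on `(-1, 1)` with density proportional to `(1 - x²)^K`. -/
def symBeta (K : ℕ) : Measure ℝ :=
  volume.withDensity fun x => ENNReal.ofReal (betaWeight K x / betaMass K)

lemma betaWeight_nonneg (K : ℕ) (x : ℝ) : 0 ≤ betaWeight K x := by
  refine Set.indicator_nonneg (fun x hx => pow_nonneg ?_ _) x
  have := (sq_lt_one_iff_abs_lt_one x).2 (abs_lt.2 hx)
  linarith

lemma integrable_betaWeight (K : ℕ) : Integrable (betaWeight K) := by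
  refine IntegrableOn.integrable_indicator ?_ measurableSet_Ioo
  exact (Continuous.integrableOn_Icc (by fun_prop)).mono_set Set.Ioo_subset_Icc_self

lemma measurable_betaWeight (K : ℕ) : Measurable (betaWeight K) :=
  Measurable.indicator (by fun_prop) measurableSet_Ioo

lemma betaMass_pos (K : ℕ) : 0 < betaMass K := by
  refine (integral_pos_iff_support_of_nonneg (betaWeight_nonneg K) (integrable_betaWeight K)).2 ?_
  have : Set.Ioo (-1 : ℝ) 1 ⊆ Function.support (betaWeight K) := by
    intro x hx
    have := (sq_lt_one_iff_abs_lt_one x).2 (abs_lt.2 hx)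
    simp only [Function.mem_support, betaWeight, Set.indicator_of_mem hx]
    exact pow_ne_zero _ (by linarith)
  exact lt_of_lt_of_le (by simp) (measure_mono this)

instance (K : ℕ) : IsProbabilityMeasure (symBeta K) := by
  refine ⟨?_⟩
  have hi := (integrable_betaWeight K).div_const (betaMass K)
  rw [symBeta, withDensity_apply _ MeasurableSet.univ, Measure.restrict_univ,
    ← ofReal_integral_eq_lintegral_ofReal hi, integral_div, ← betaMass,
    div_self (betaMass_pos K).ne', ENNReal.ofReal_one]
  exact ae_of_all _ fun x => div_nonneg (betaWeight_nonneg K x) (betaMass_pos K).le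

lemma pi_symBeta {ι : Type*} [Fintype ι] (K : ι → ℕ) :
    Measure.pi (fun i => symBeta (K i)) = (volume : Measure (ι → ℝ)).withDensity
      fun x => ENNReal.ofReal (∏ i, betaWeight (K i) (x i) / betaMass (K i)) :=
  pi_withDensity_ofReal
    (fun i x => div_nonneg (betaWeight_nonneg (K i) x) (betaMass_pos (K i)).le)
    fun i => (integrable_betaWeight (K i)).div_const _

/-! ### The uniform distribution on the moment space -/

lemma measurableSet_openCube (N : ℕ) : MeasurableSet (openCube N) :=
  MeasurableSet.univ_pi fun _ => measurableSet_Ioo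

/-- The moment space lies between the images of the open and of the closed cube. The faces are null,
and a differentiable map sends null sets to null sets. -/
lemma momentSpace_ae_eq (N : ℕ) :
    momentSpace N =ᵐ[volume] momentMap N '' openCube N := by
  refine (ae_eq_set.2 ⟨?_, ?_⟩)
  · have hsub : momentSpace N \ momentMap N '' openCube N ⊆
        momentMap N '' ((Set.univ.pi fun _ => Set.Icc (-1) 1) \ openCube N) := by
      rintro c ⟨hc, hc'⟩
      obtain ⟨α, hα, rfl⟩ := momentSpace_subset N hc
      exact ⟨α, ⟨hα, fun h => hc' ⟨α, h, rfl⟩⟩, rfl⟩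
    refine measure_mono_null hsub ?_
    refine addHaar_image_eq_zero_of_differentiableOn_of_addHaar_eq_zero volume
      ((contDiff_momentMap N).differentiable one_ne_zero).differentiableOn ?_
    exact (ae_eq_set.1 (Measure.univ_pi_Ioo_ae_eq_Icc
      (μ := fun _ : Fin N => (volume : Measure ℝ)) (f := fun _ => -1) (g := fun _ => 1))).2 ▸ by
      simp only [← Set.pi_univ_Icc]; rfl
  · rw [Set.sdiff_eq_empty.2 (image_openCube_subset N), measure_empty]

lemma measurableSet_image_openCube (N : ℕ) : MeasurableSet (momentMap N '' openCube N) :=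
  (measurableSet_openCube N).image_of_continuousOn_injOn
    (contDiff_momentMap N).continuous.continuousOn (momentMap_injOn N)

/-- The law of independent Verblunsky coefficients corresponding to uniform moments. -/
def verblunskyLaw (N : ℕ) : Measure (Fin N → ℝ) := Measure.pi fun j => symBeta (N - 1 - j)

instance (N : ℕ) : IsProbabilityMeasure (verblunskyLaw N) := by
  unfold verblunskyLaw; infer_instance

/-- Change of variables: the Jacobian determinant is, up to constants, the product of the beta
weights. The total mass of the right-hand side also yields the volume of the moment space. -/
lemma restrict_momentSpace (N : ℕ) :
    (volume : Measure (Fin N → ℝ)).restrict (momentSpace N) =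
      ENNReal.ofReal (jacConst N * ∏ j : Fin N, betaMass (N - 1 - j)) •
        (verblunskyLaw N).map (momentMap N) := by
  have hcont := (contDiff_momentMap N).continuous
  have hB : 0 < ∏ j : Fin N, betaMass (N - 1 - j) := Finset.prod_pos fun j _ => betaMass_pos _
  have hc : 0 ≤ jacConst N * ∏ j : Fin N, betaMass (N - 1 - j) :=
    mul_nonneg (jacConst_pos N).le hB.le
  rw [Measure.restrict_congr_set (momentSpace_ae_eq N)]
  ext s hs
  have h1 : (volume : Measure (Fin N → ℝ)).restrict (momentMap N '' openCube N) s =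
      ∫⁻ x in momentMap N '' openCube N, s.indicator 1 x := by
    rw [lintegral_indicator_one hs]
  rw [h1, lintegral_image_eq_lintegral_abs_det_fderiv_mul volume (measurableSet_openCube N)
    (fun x _ => (((contDiff_momentMap N).differentiable one_ne_zero x).hasFDerivAt).hasFDerivWithinAt)
    (momentMap_injOn N), Measure.smul_apply, Measure.map_apply hcont.measurable hs, verblunskyLaw,
    pi_symBeta, withDensity_apply _ (hcont.measurable hs), smul_eq_mul, ← lintegral_const_mul',
    ← lintegral_indicator (measurableSet_openCube N),
    ← lintegral_indicator (hcont.measurable hs)]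
  · refine lintegral_congr fun α => ?_
    by_cases hα : α ∈ openCube N
    · rw [Set.indicator_of_mem hα, det_fderiv_momentMap]
      by_cases hs' : momentMap N α ∈ s
      · have hw : ∀ j : Fin N, betaWeight (N - 1 - j) (α j) = (1 - α j ^ 2) ^ (N - 1 - (j : ℕ)) :=
          fun j => Set.indicator_of_mem (hα j trivial) _
        have hnn : 0 ≤ ∏ j : Fin N, (1 - α j ^ 2) ^ (N - 1 - (j : ℕ)) :=
          Finset.prod_nonneg fun j _ => hw j ▸ betaWeight_nonneg _ _
        rw [Set.indicator_of_mem hs', Set.indicator_of_mem (show α ∈ momentMap N ⁻¹' s from hs'),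
          ← ENNReal.ofReal_mul hc, Pi.one_apply, mul_one, Finset.prod_div_distrib,
          abs_of_nonneg (mul_nonneg (jacConst_pos N).le hnn)]
        simp_rw [hw]
        congr 1
        field_simp
      · rw [Set.indicator_of_notMem hs',
          Set.indicator_of_notMem (show α ∉ momentMap N ⁻¹' s from hs'), mul_zero]
    · rw [Set.indicator_of_notMem hα]
      have : ∃ j : Fin N, α j ∉ Set.Ioo (-1 : ℝ) 1 := by
        simpa [openCube, Set.mem_pi] using hα
      obtain ⟨j, hj⟩ := this
      have h0 : ∏ i : Fin N, betaWeight (N - 1 - i) (α i) / betaMass (N - 1 - i) = 0 :=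
        Finset.prod_eq_zero (Finset.mem_univ j) (by
          rw [betaWeight, Set.indicator_of_notMem hj, zero_div])
      by_cases hs' : α ∈ momentMap N ⁻¹' s
      · rw [Set.indicator_of_mem hs', h0]; simp
      · rw [Set.indicator_of_notMem hs']
  · exact ENNReal.ofReal_ne_top

lemma volume_momentSpace (N : ℕ) : volume (momentSpace N) =
    ENNReal.ofReal (jacConst N * ∏ j : Fin N, betaMass (N - 1 - j)) := by
  have := Measure.isProbabilityMeasure_map (μ := verblunskyLaw N)
    (contDiff_momentMap N).continuous.aemeasurable
  rw [← Measure.restrict_apply_univ, restrict_momentSpace, Measure.smul_apply, measure_univ,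
    smul_eq_mul, mul_one]

lemma volume_momentSpace_ne_zero (N : ℕ) : volume (momentSpace N) ≠ 0 := by
  rw [volume_momentSpace, Ne, ENNReal.ofReal_eq_zero, not_le]
  exact mul_pos (jacConst_pos N) (Finset.prod_pos fun j _ => betaMass_pos _)

lemma volume_momentSpace_ne_top (N : ℕ) : volume (momentSpace N) ≠ ⊤ := by
  rw [volume_momentSpace]; exact ENNReal.ofReal_ne_top

/-- The uniform distribution on the moment space is the image of a product of symmetric beta
distributions. -/
lemma cond_momentSpace (N : ℕ) :
    ProbabilityTheory.cond volume (momentSpace N) = (verblunskyLaw N).map (momentMap N) := by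
  rw [ProbabilityTheory.cond, restrict_momentSpace, ← volume_momentSpace, smul_smul,
    ENNReal.inv_mul_cancel (volume_momentSpace_ne_zero N) (volume_momentSpace_ne_top N), one_smul]

lemma ae_mem_image_openCube (N : ℕ) :
    ∀ᵐ c ∂(ProbabilityTheory.cond volume (momentSpace N)), c ∈ momentMap N '' openCube N := by
  rw [ProbabilityTheory.cond, Measure.restrict_congr_set (momentSpace_ae_eq N)]
  exact Measure.ae_smul_measure (ae_restrict_mem (measurableSet_image_openCube N)) _

/-- The law of the first coordinates of a product measure. -/
lemma map_castLE_pi {d N : ℕ} (h : d ≤ N) (ν : Fin N → Measure ℝ)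
    [∀ i, IsProbabilityMeasure (ν i)] :
    (Measure.pi ν).map (fun α (j : Fin d) => α (Fin.castLE h j)) =
      Measure.pi fun j : Fin d => ν (Fin.castLE h j) := by
  symm
  refine Measure.pi_eq fun s hs => ?_
  rw [Measure.map_apply (by fun_prop) (MeasurableSet.univ_pi hs)]
  set t : Fin N → Set ℝ := fun i => if hi : (i : ℕ) < d then s ⟨i, hi⟩ else Set.univ with ht
  have hpre : (fun (α : Fin N → ℝ) (j : Fin d) => α (Fin.castLE h j)) ⁻¹' (Set.univ.pi s) =
      Set.univ.pi t := by
    ext α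
    simp only [Set.mem_preimage, Set.mem_pi, Set.mem_univ, true_implies]
    constructor
    · intro hα i
      by_cases hi : (i : ℕ) < d
      · simpa [ht, hi] using hα ⟨i, hi⟩
      · simp [ht, hi]
    · intro hα j
      have := hα (Fin.castLE h j)
      simpa [ht] using this
  rw [hpre, Measure.pi_pi]
  refine (Finset.prod_of_injOn (Fin.castLE h) (Fin.castLE_injective h).injOn (by simp) ?_ ?_).symm
  · intro i _ hi
    have : ¬ (i : ℕ) < d := fun hid => hi ⟨⟨i, hid⟩, by simp⟩
    simp [ht, this]
  · intro j _
    simp [ht]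

end RandomOrthPoly
end

noncomputable section

open Polynomial

namespace RandomOrthPoly

/-! ### Determinantal formula for orthogonal polynomials -/

/-- A monic polynomial orthogonal to the lower powers is given by the determinantal formula. -/
lemma orthPoly_eq_of_orthogonal {N : ℕ} {c : Fin N → ℝ} {m : ℕ} (hH : hankelDet c m ≠ 0)
    {P : ℝ[X]} (hP : P.coeff m = 1) (hdeg : P.natDegree ≤ m)
    (horth : ∀ j < m, ∑ i ∈ Finset.range (m + 1), P.coeff i * momentCoord c (i + j) = 0) :
    orthPoly c m = P := by
  set M : Matrix (Fin (m + 1)) (Fin (m + 1)) ℝ[X] := Matrix.of fun i j : Fin (m + 1) =>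
      if (j : ℕ) < m then C (momentCoord c ((i : ℕ) + (j : ℕ)))
      else (X : ℝ[X]) ^ (i : ℕ) with hM
  -- The last row is replaced by the combination of all rows with the coefficients of P. As P_m = 1
  -- the determinant does not change, and orthogonality leaves P as the only nonzero entry of the
  -- new row.
  have h1 := Matrix.det_updateRow_sum M (Fin.last m) fun i => C (P.coeff i)
  have hrow : (∑ i : Fin (m + 1), C (P.coeff i) • M i) = Pi.single (Fin.last m) P := by
    ext1 j
    rw [Finset.sum_apply]
    simp only [Pi.smul_apply, smul_eq_mul, hM, Matrix.of_apply]
    by_cases hj : (j : ℕ) < m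
    · have hne : j ≠ Fin.last m := fun h => by simp [h] at hj
      simp only [hj, if_true, Pi.single_eq_of_ne hne]
      rw [← Finset.sum_range fun i => C (P.coeff i) * C (momentCoord c (i + j))]
      simp_rw [← C_mul]
      rw [← map_sum, horth j hj, C_0]
    · obtain rfl : j = Fin.last m := Fin.ext (by simp; omega)
      simp only [hj, if_false, Pi.single_eq_same]
      rw [← Finset.sum_range fun i => C (P.coeff i) * X ^ i]
      exact (P.as_sum_range_C_mul_X_pow' (by omega)).symm
  have hdet : M.det = P * C (hankelDet c m) := by
    have h2 : M.det = (M.updateRow (Fin.last m) (Pi.single (Fin.last m) P)).det := by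
      rw [← hrow, h1]; simp [hP]
    rw [h2, Matrix.det_succ_row _ (Fin.last m), Finset.sum_eq_single (Fin.last m)]
    · rw [Matrix.updateRow_self, Pi.single_eq_same, Even.neg_one_pow (by simp), one_mul, hankelDet,
        RingHom.map_det]
      congr 2
      ext1 i j
      simp only [Fin.succAbove_last, Matrix.submatrix_apply, RingHom.mapMatrix_apply,
        Matrix.map_apply, Matrix.of_apply]
      rw [Matrix.updateRow_ne (Fin.castSucc_lt_last i).ne]
      simp [hM]
    · intro j _ hj
      rw [Matrix.updateRow_self, Pi.single_eq_of_ne hj]; simp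
    · simp
  rw [orthPoly, ← hM, hdet, mul_comm P, ← mul_assoc, ← C_mul, inv_mul_cancel₀ hH, C_1, one_mul]

/-! ### Nonvanishing Hankel determinants and real roots -/

section Measure

variable {a : ℕ → ℝ} {η : Measure ℝ} [IsProbabilityMeasure η]

lemma integrable_eval (hη : η (Set.Icc (0 : ℝ) 1)ᶜ = 0) (R : ℝ[X]) :
    Integrable (fun x => R.eval x) η := by
  obtain ⟨K, hK⟩ := (isCompact_Icc (a := (0 : ℝ)) (b := 1)).exists_bound_of_continuousOn
    (f := fun x => R.eval x) R.continuous.continuousOn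
  have : ∀ᵐ x ∂η, x ∈ Set.Icc (0 : ℝ) 1 := hη
  refine Integrable.of_bound R.continuous.aestronglyMeasurable K ?_
  filter_upwards [this] with x hx using hK x hx

lemma integral_eval_mul_pow (hη : η (Set.Icc (0 : ℝ) 1)ᶜ = 0) {R : ℝ[X]} {n : ℕ}
    (hR : R.natDegree < n) (j : ℕ) :
    ∫ x, R.eval x * x ^ j ∂η = ∑ i ∈ Finset.range n, R.coeff i * ∫ x, x ^ (i + j) ∂η := by
  have hpow : ∀ k, Integrable (fun x : ℝ => x ^ k) η := fun k => by
    simpa using integrable_eval hη (X ^ k)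
  have : ∀ x, R.eval x * x ^ j = ∑ i ∈ Finset.range n, R.coeff i * x ^ (i + j) := fun x => by
    rw [eval_eq_sum_range' hR, Finset.sum_mul]
    exact Finset.sum_congr rfl fun i _ => by ring
  simp_rw [this]
  rw [integral_finsetSum _ fun i _ => (hpow _).const_mul _]
  exact Finset.sum_congr rfl fun i _ => integral_const_mul _ _

lemma integral_eval_mul_eval (hη : η (Set.Icc (0 : ℝ) 1)ᶜ = 0) (P : ℝ[X]) {R : ℝ[X]} {n : ℕ}
    (hR : R.natDegree < n) :
    ∫ x, P.eval x * R.eval x ∂η = ∑ j ∈ Finset.range n, R.coeff j * ∫ x, P.eval x * x ^ j ∂η := by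
  have : ∀ x, P.eval x * R.eval x = ∑ j ∈ Finset.range n, R.coeff j * (P.eval x * x ^ j) :=
    fun x => by
      rw [eval_eq_sum_range' hR, Finset.mul_sum]
      exact Finset.sum_congr rfl fun i _ => by ring
  simp_rw [this]
  rw [integral_finsetSum]
  · exact Finset.sum_congr rfl fun i _ => integral_const_mul _ _
  · intro j _
    refine Integrable.const_mul ?_ _
    exact (integrable_eval hη (P * X ^ j)).congr (ae_of_all _ fun x => by simp)

lemma momentCoord_eq_integral {N : ℕ} {c : Fin N → ℝ} (hc : ∀ i : Fin N, c i = ∫ x, x ^ ((i : ℕ) + 1) ∂η)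
    {k : ℕ} (hk : k ≤ N) : momentCoord c k = ∫ x, x ^ k ∂η := by
  cases k with
  | zero => simp [momentCoord]
  | succ k => rw [momentCoord, dif_pos (by omega), hc]

variable (hη : η (Set.Icc (0 : ℝ) 1)ᶜ = 0) {N : ℕ} (ha : ∀ j < N, |a j| < 1)
  (htrig : ∀ k ≤ N, trigInt η k = trigMoment a k)

include hη ha htrig

/-- A kernel vector, read as a polynomial R of degree below m, satisfies ∫ R x^j = 0 for all j < m,
hence ∫ R² = 0, and R = 0 by `eq_zero_of_ae_eval_eq_zero`. -/
lemma hankelDet_ne_zero {c : Fin N → ℝ} (hc : ∀ i : Fin N, c i = ∫ x, x ^ ((i : ℕ) + 1) ∂η)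
    {m : ℕ} (hm : 2 * m ≤ N + 1) : hankelDet c m ≠ 0 := by
  intro h0
  obtain ⟨v, hv, hHv⟩ := Matrix.exists_mulVec_eq_zero_iff.2 h0
  have hm1 : 0 < m := by
    rcases Nat.eq_zero_or_pos m with rfl | h
    · exact absurd (Subsingleton.elim v 0) hv
    · exact h
  set R : ℝ[X] := ∑ i : Fin m, C (v i) * X ^ (i : ℕ) with hR
  have hcoeff : ∀ i : Fin m, R.coeff i = v i := fun i => by
    rw [hR, finsetSum_coeff, Finset.sum_eq_single i]
    · simp
    · intro j _ hj
      rw [coeff_C_mul, coeff_X_pow, if_neg (fun h => hj (Fin.ext h.symm)), mul_zero]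
    · simp
  have hdeg : R.natDegree ≤ m - 1 := natDegree_sum_le_of_forall_le _ _ fun i _ =>
    (natDegree_C_mul_X_pow_le _ _).trans (by omega)
  have hlt : R.natDegree < m := by omega
  have hzero : ∀ j < m, ∫ x, R.eval x * x ^ j ∂η = 0 := by
    intro j hj
    have := congr_fun hHv ⟨j, hj⟩
    rw [Matrix.mulVec, dotProduct] at this
    simp only [Matrix.of_apply, Pi.zero_apply] at this
    rw [integral_eval_mul_pow hη hlt, ← this,
      Finset.sum_range fun i => R.coeff i * ∫ x, x ^ (i + j) ∂η]
    refine Finset.sum_congr rfl fun i _ => ?_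
    rw [hcoeff, momentCoord_eq_integral hc (by omega), mul_comm, add_comm]
  have hsq : ∫ x, R.eval x * R.eval x ∂η = 0 := by
    rw [integral_eval_mul_eval hη R hlt]
    exact Finset.sum_eq_zero fun j hj => by rw [hzero j (Finset.mem_range.1 hj), mul_zero]
  have hae := (integral_eq_zero_iff_of_nonneg (fun x => mul_self_nonneg _)
    (by simpa using integrable_eval hη (R * R))).1 hsq
  have hR0 : R = 0 := by
    refine eq_zero_of_ae_eval_eq_zero hη ha htrig (by omega) ?_
    filter_upwards [hae] with x hx using mul_self_eq_zero.1 hx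
  apply hv
  ext i
  rw [← hcoeff, hR0]; simp

/-- Orthogonal polynomials of measures on the line have only real roots. -/
lemma splits_of_orthogonal {m : ℕ} (hm : 2 * m ≤ N + 1) {P : ℝ[X]} (hP : P ≠ 0)
    (hdeg : P.natDegree ≤ m) (horth : ∀ j < m, ∫ x, P.eval x * x ^ j ∂η = 0) : P.Splits := by
  rw [splits_iff_splits]
  refine Or.inr fun {q} hq hqP => ?_
  by_contra hq1
  have hq2 : q.degree = 2 := by
    have h1 := hq.degree_le_two
    have h2 := hq.degree_pos
    rw [degree_eq_natDegree hq.ne_zero] at *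
    norm_cast at *
    omega
  have hqn : q.natDegree = 2 := natDegree_eq_of_degree_eq_some hq2
  -- An irreducible quadratic factor q has constant sign, while ∫ (qR) R = 0 because deg R < m. So
  -- qR² and with it R vanish almost everywhere, which forces R = 0.
  obtain ⟨R, rfl⟩ := hqP
  have hR0 : R ≠ 0 := right_ne_zero_of_mul hP
  have hRdeg : R.natDegree + 2 ≤ m := by
    rw [natDegree_mul hq.ne_zero hR0, hqn] at hdeg; omega
  have hroot : ∀ x, q.eval x ≠ 0 := fun x hx => by
    have := degree_eq_one_of_irreducible_of_root hq hx
    exact hq1 this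
  have hint : ∫ x, (q * R).eval x * R.eval x ∂η = 0 := by
    rw [integral_eval_mul_eval hη _ (show R.natDegree < m by omega)]
    exact Finset.sum_eq_zero fun j hj => by rw [horth j (Finset.mem_range.1 hj), mul_zero]
  have hinteg : Integrable (fun x => (q * R).eval x * R.eval x) η := by
    simpa using integrable_eval hη (q * R * R)
  have hsign : (∀ x, 0 < q.eval x) ∨ ∀ x, q.eval x < 0 := by
    by_contra! h
    obtain ⟨⟨x, hx⟩, ⟨y, hy⟩⟩ := h
    obtain ⟨z, hz⟩ := mem_range_of_exists_le_of_exists_ge q.continuous ⟨x, hx⟩ ⟨y, hy⟩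
    exact hroot z hz
  have hae : (fun x => (q * R).eval x * R.eval x) =ᵐ[η] 0 := by
    rcases hsign with h | h
    · refine (integral_eq_zero_iff_of_nonneg (fun x => ?_) hinteg).1 hint
      have := h x
      simp only [eval_mul, Pi.zero_apply]
      rw [mul_assoc]
      exact mul_nonneg this.le (mul_self_nonneg _)
    · have h2 : ∫ x, -((q * R).eval x * R.eval x) ∂η = 0 := by rw [integral_neg, hint, neg_zero]
      have h3 := (integral_eq_zero_iff_of_nonneg (fun x => ?_) hinteg.neg).1 h2
      · filter_upwards [h3] with x hx
        simpa using hx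
      · have := h x
        simp only [eval_mul, Pi.zero_apply, Pi.neg_apply]
        rw [mul_assoc, ← neg_mul]
        exact mul_nonneg (by linarith) (mul_self_nonneg _)
  refine hR0 (eq_zero_of_ae_eval_eq_zero hη ha htrig (by omega) ?_)
  filter_upwards [hae] with x hx
  simpa [hroot x] using hx

end Measure

/-! ### The orthogonal polynomial in terms of the Verblunsky coefficients -/

/-- The Chebyshev polynomial on `[0,1]`. -/
def shiftedT (n : ℤ) : ℝ[X] := (Chebyshev.T ℝ n).comp (2 * X - 1)

/-- The monic orthogonal polynomial of degree `m` on `[0,1]` with Verblunsky coefficients `a`. -/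
def verblunskyPoly (a : ℕ → ℝ) (m : ℕ) : ℝ[X] :=
  C (2 ^ (2 * m - 1) : ℝ)⁻¹ *
    ∑ i ∈ Finset.range (2 * m), C ((szego a (2 * m - 1)).coeff i) * shiftedT ((i : ℤ) + 1 - m)

lemma natDegree_two_mul_X_sub_one : (2 * X - 1 : ℝ[X]).natDegree = 1 := by
  rw [show (2 * X - 1 : ℝ[X]) = C 2 * X - C 1 by rw [C_1]; rfl, natDegree_sub_C, natDegree_C_mul_X _ two_ne_zero]

lemma natDegree_shiftedT (n : ℤ) : (shiftedT n).natDegree = n.natAbs := by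
  rw [shiftedT, natDegree_comp, natDegree_two_mul_X_sub_one, Chebyshev.natDegree_T, mul_one]

lemma coeff_shiftedT_self {m : ℕ} (hm : 1 ≤ m) : (shiftedT m).coeff m = 2 ^ (2 * m - 1) := by
  have h1 : (shiftedT m).leadingCoeff = 2 ^ (2 * m - 1) := by
    rw [shiftedT, leadingCoeff_comp (by rw [natDegree_two_mul_X_sub_one]; exact one_ne_zero),
      Chebyshev.leadingCoeff_T, Chebyshev.natDegree_T]
    have : (2 * X - 1 : ℝ[X]).leadingCoeff = 2 := by
      rw [leadingCoeff, natDegree_two_mul_X_sub_one]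
      simp [coeff_one]
    rw [this, ← pow_add]
    congr 1
    simp; omega
  have h2 := natDegree_shiftedT m
  rw [leadingCoeff, h2] at h1
  simpa using h1

lemma shiftedT_eval_cos (n : ℤ) (φ : ℝ) :
    (shiftedT n).eval ((Real.cos φ + 1) / 2) = Real.cos (n * φ) := by
  rw [shiftedT, eval_comp, ← Chebyshev.T_real_cos]
  congr 1
  simp; ring

lemma shiftedT_eval {x : ℝ} (hx : x ∈ Set.Icc (0 : ℝ) 1) (n : ℤ) :
    (shiftedT n).eval x = Real.cos (n * angle x) := by
  rw [← shiftedT_eval_cos, angle, Real.cos_arccos (by linarith [hx.1]) (by linarith [hx.2])]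
  congr 1
  ring

lemma verblunskyPoly_natDegree_le (a : ℕ → ℝ) (m : ℕ) : (verblunskyPoly a m).natDegree ≤ m := by
  refine (natDegree_C_mul_le _ _).trans (natDegree_sum_le_of_forall_le _ _ fun i hi => ?_)
  have := Finset.mem_range.1 hi
  refine (natDegree_C_mul_le _ _).trans ?_
  rw [natDegree_shiftedT]
  omega

lemma verblunskyPoly_coeff_self (a : ℕ → ℝ) {m : ℕ} (hm : 1 ≤ m) :
    (verblunskyPoly a m).coeff m = 1 := by
  rw [verblunskyPoly, coeff_C_mul, finsetSum_coeff, show 2 * m = (2 * m - 1) + 1 by omega,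
    Finset.sum_range_succ, Finset.sum_eq_zero, zero_add, add_tsub_cancel_right, szego_coeff_self,
    coeff_C_mul, one_mul]
  · have : ((2 * m - 1 : ℕ) : ℤ) + 1 - m = m := by omega
    rw [this, coeff_shiftedT_self hm, inv_mul_cancel₀ (by positivity)]
  · intro i hi
    have := Finset.mem_range.1 hi
    rw [coeff_C_mul, coeff_eq_zero_of_natDegree_lt (p := shiftedT _), mul_zero]
    rw [natDegree_shiftedT]
    omega

lemma verblunskyPoly_monic (a : ℕ → ℝ) {m : ℕ} (hm : 1 ≤ m) : (verblunskyPoly a m).Monic :=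
  monic_of_natDegree_le_of_coeff_eq_one m (verblunskyPoly_natDegree_le a m)
    (verblunskyPoly_coeff_self a hm)

lemma verblunskyPoly_natDegree (a : ℕ → ℝ) {m : ℕ} (hm : 1 ≤ m) :
    (verblunskyPoly a m).natDegree = m :=
  natDegree_eq_of_le_of_coeff_ne_zero (verblunskyPoly_natDegree_le a m)
    (by rw [verblunskyPoly_coeff_self a hm]; exact one_ne_zero)

lemma verblunskyPoly_congr {a b : ℕ → ℝ} {m : ℕ} (h : ∀ j < 2 * m - 1, a j = b j) :
    verblunskyPoly a m = verblunskyPoly b m := by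
  rw [verblunskyPoly, szego_congr h, verblunskyPoly]

/-- The coefficient of z^i in Φ_{2m-1} contributes cos((i+1-m)θ), which is T_{i+1-m}. In this form
orthogonality on the circle carries over to [0,1]. -/
lemma verblunskyPoly_eval (a : ℕ → ℝ) {m : ℕ} (hm : 1 ≤ m) {x : ℝ} (hx : x ∈ Set.Icc (0 : ℝ) 1) :
    (verblunskyPoly a m).eval x = (2 ^ (2 * m - 1))⁻¹ *
      (aeval (circlePt x) (szego a (2 * m - 1)) * circlePt x ^ (-((m : ℤ) - 1))).re := by
  rw [verblunskyPoly, eval_mul, eval_C, eval_finsetSum, aeval_mul_zpow_re, szego_natDegree,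
    show 2 * m - 1 + 1 = 2 * m by omega]
  congr 1
  refine Finset.sum_congr rfl fun i _ => ?_
  rw [eval_mul, eval_C, shiftedT_eval hx, mul_comm]
  congr 3
  push_cast; ring

lemma verblunskyPoly_orthogonal {a : ℕ → ℝ} {η : Measure ℝ} [IsProbabilityMeasure η]
    (hη : η (Set.Icc (0 : ℝ) 1)ᶜ = 0) {N : ℕ} (htrig : ∀ k ≤ N, trigInt η k = trigMoment a k)
    {m : ℕ} (hm : 1 ≤ m) (hmN : 2 * m ≤ N + 1) {j : ℕ} (hj : j < m) :
    ∫ x, (verblunskyPoly a m).eval x * x ^ j ∂η = 0 := by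
  -- On the circle z^{m-1} (4x)^j = z^{m-1-j} (1+z)^{2j}, of degree m-1+j < 2m-1, so Φ_{2m-1} is
  -- orthogonal to it.
  set g : ℝ[X] := X ^ (m - 1 - j) * (1 + X) ^ (2 * j) with hg
  have hgd : g.natDegree ≤ m - 1 + j := by
    refine natDegree_mul_le.trans ?_
    rw [natDegree_X_pow, natDegree_one_add_X_pow]; omega
  have key := integral_mul_conj_szego htrig (k := 2 * m - 1) (by omega) (g := g) (by omega)
  rw [coeff_eq_zero_of_natDegree_lt (by omega), zero_mul] at key
  have : ∀ᵐ x ∂η, x ∈ Set.Icc (0 : ℝ) 1 := hη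
  have hpt : ∀ᵐ x ∂η, (verblunskyPoly a m).eval x * x ^ j = ((2 ^ (2 * m - 1))⁻¹ * (4 ^ j)⁻¹) *
      (aeval (circlePt x) (szego a (2 * m - 1)) *
        (starRingEnd ℂ) (aeval (circlePt x) g)).re := by
    filter_upwards [this] with x hx
    have hgz : aeval (circlePt x) g = ((4 * x) ^ j : ℝ) * circlePt x ^ (m - 1) := by
      simp only [hg, map_mul, map_pow, map_add, map_one, aeval_X]
      rw [pow_mul, one_add_circlePt_sq hx, mul_pow]
      have : circlePt x ^ (m - 1) = circlePt x ^ (m - 1 - j) * circlePt x ^ j := by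
        rw [← pow_add, Nat.sub_add_cancel (by omega)]
      rw [this]
      push_cast; ring
    have hz : (starRingEnd ℂ) (aeval (circlePt x) g) =
        ((4 * x) ^ j : ℝ) * circlePt x ^ (-((m : ℤ) - 1)) := by
      rw [hgz, map_mul, Complex.conj_ofReal, conj_circlePt_pow]
      congr 3
      omega
    rw [verblunskyPoly_eval a hm hx, hz, mul_left_comm _ (((4 * x) ^ j : ℝ) : ℂ),
      Complex.re_ofReal_mul, mul_pow]
    field_simp
  rw [integral_congr_ae hpt, integral_const_mul, key, mul_zero]

/-- The random orthogonal polynomial is a fixed function of the Verblunsky coefficients. -/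
lemma orthPoly_momentMap {N m : ℕ} (hm : 1 ≤ m) (hmN : 2 * m ≤ N + 1) {α : Fin N → ℝ}
    (hα : α ∈ openCube N) :
    orthPoly (momentMap N α) m = verblunskyPoly (extend α) m ∧
      (verblunskyPoly (extend α) m).Splits := by
  obtain ⟨η, hprob, hη, htrig, hc⟩ := exists_measure_momentMap hα
  have ha := abs_extend_lt hα
  have horth : ∀ j < m, ∫ x, (verblunskyPoly (extend α) m).eval x * x ^ j ∂η = 0 :=
    fun j hj => verblunskyPoly_orthogonal hη htrig hm hmN hj
  have hdeg := verblunskyPoly_natDegree_le (extend α) m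
  refine ⟨orthPoly_eq_of_orthogonal (hankelDet_ne_zero hη ha htrig hc hmN)
    (verblunskyPoly_coeff_self _ hm) hdeg fun j hj => ?_,
    splits_of_orthogonal hη ha htrig hmN (verblunskyPoly_monic _ hm).ne_zero hdeg horth⟩
  rw [← horth j hj, integral_eval_mul_pow hη (Nat.lt_succ_of_le hdeg)]
  refine Finset.sum_congr rfl fun i hi => ?_
  have := Finset.mem_range.1 hi
  rw [momentCoord_eq_integral hc (by omega)]

end RandomOrthPoly
end

noncomputable section

open Polynomial

namespace RandomOrthPoly

/-! ### Ordered roots -/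

lemma eq_of_eval_eq {ι : Type*} [Fintype ι] {p q : ℝ[X]} (hp : p.Monic) (hq : q.Monic)
    (hpd : p.natDegree = Fintype.card ι) (hqd : q.natDegree = Fintype.card ι) {v : ι → ℝ}
    (hv : Function.Injective v) (h : ∀ i, p.eval (v i) = q.eval (v i)) : p = q := by
  refine eq_of_degree_sub_lt_of_eval_index_eq Finset.univ hv.injOn ?_ fun i _ => h i
  have hd : p.degree = q.degree := by
    rw [degree_eq_natDegree hp.ne_zero, degree_eq_natDegree hq.ne_zero, hpd, hqd]
  refine (degree_sub_lt_left hd hp.ne_zero (hp.trans hq.symm)).trans_le ?_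
  rw [degree_eq_natDegree hp.ne_zero, hpd, Finset.card_univ]

lemma monic_prod_X_sub_C {m : ℕ} (y : Fin m → ℝ) : (∏ k, (X - C (y k))).Monic :=
  monic_prod_of_monic _ _ fun _ _ => monic_X_sub_C _

lemma natDegree_prod_X_sub_C {m : ℕ} (y : Fin m → ℝ) : (∏ k, (X - C (y k))).natDegree = m := by
  simp

lemma roots_sort_ofFn {m : ℕ} {y : Fin m → ℝ} (hy : Antitone y) :
    (∏ k, (X - C (y k))).roots.sort (· ≥ ·) = List.ofFn y := by
  refine List.Perm.eq_of_pairwise' (r := (· ≥ ·)) (Multiset.pairwise_sort _ _) ?_ ?_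
  · exact List.pairwise_ofFn.2 fun i j hij => hy hij.le
  · rw [← Multiset.coe_eq_coe, Multiset.sort_eq, ← Finset.prod_map_val,
      show (Multiset.map (fun k => X - C (y k)) (Finset.univ : Finset (Fin m)).val) =
        ((Finset.univ : Finset (Fin m)).val.map y).map (fun r => X - C r) by
          rw [Multiset.map_map]; rfl,
      roots_multiset_prod_X_sub_C]
    simp [List.ofFn_eq_map, Fin.univ_def]

lemma orderedRoots_prod {m : ℕ} {y : Fin m → ℝ} (hy : Antitone y) :
    orderedRoots (∏ k, (X - C (y k))) m = WithLp.toLp 2 y := by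
  unfold orderedRoots
  rw [roots_sort_ofFn hy]
  congr with k
  simp

lemma eq_of_prod_eq {m : ℕ} {y z : Fin m → ℝ} (hy : Antitone y) (hz : Antitone z)
    (h : ∏ k, (X - C (y k)) = ∏ k, (X - C (z k))) : y = z := by
  have h1 := orderedRoots_prod hy
  rw [h, orderedRoots_prod hz] at h1
  exact (WithLp.toLp_injective 2 h1).symm

lemma orderedRoots_spec {P : ℝ[X]} {m : ℕ} (hP : P.Monic) (hd : P.natDegree = m)
    (hs : P.Splits) : Antitone (fun k => orderedRoots P m k) ∧
      P = ∏ k : Fin m, (X - C (orderedRoots P m k)) := by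
  set l := P.roots.sort (· ≥ ·) with hl
  have hlen : l.length = m := by
    rw [hl, Multiset.length_sort, ← hs.natDegree_eq_card_roots, hd]
  have hget : ∀ k : Fin m, orderedRoots P m k = l[(k : ℕ)]'(by omega) := fun k => by
    simp only [orderedRoots, ← hl]
    rw [List.getD_eq_getElem]
  constructor
  · intro i j hij
    simp only [hget]
    obtain hij | rfl := hij.lt_or_eq
    · exact List.pairwise_iff_getElem.1 (Multiset.pairwise_sort P.roots (· ≥ ·)) i j _ _ hij
    · exact le_rfl
  · have h1 : (P.roots.map (X - C ·)).prod = (l.map (X - C ·)).prod := by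
      rw [← Multiset.prod_coe, ← Multiset.map_coe, hl, Multiset.sort_eq]
    conv_lhs => rw [hs.eq_prod_roots_of_monic hP, h1]
    simp_rw [hget]
    subst hlen
    exact (Fin.prod_univ_fun_getElem l (X - C ·)).symm

/-- The ordered roots are a measurable function of the values of the polynomial. -/
lemma exists_measurable_orderedRoots (m : ℕ) : ∃ g : (Fin m → ℝ) → EuclideanSpace ℝ (Fin m),
    Measurable g ∧ ∀ P : ℝ[X], P.Monic → P.natDegree = m → P.Splits →
      g (fun i => P.eval (i : ℝ)) = orderedRoots P m := by
  set D : Set (Fin m → ℝ) := {y | Antitone y} with hD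
  have hDm : MeasurableSet D := by
    have : IsClosed D := by
      simp only [hD, Antitone, Set.ofPred_forall]
      exact isClosed_iInter fun i => isClosed_iInter fun j => isClosed_iInter fun _ =>
        isClosed_le (continuous_apply _) (continuous_apply _)
    exact this.measurableSet
  set e : (Fin m → ℝ) → (Fin m → ℝ) := fun y i => ∏ k, ((i : ℝ) - y k) with he
  have heval : ∀ (y : Fin m → ℝ) (i : Fin m), (∏ k, (X - C (y k))).eval (i : ℝ) = e y i := by
    intro y i
    simp [he, eval_prod]
  have hinj : Set.InjOn e D := by
    intro y hy z hz h
    refine eq_of_prod_eq hy hz (eq_of_eval_eq (ι := Fin m) (monic_prod_X_sub_C y)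
      (monic_prod_X_sub_C z) (by simp) (by simp) (v := fun i => (i : ℝ)) ?_ fun i => ?_)
    · intro i j hij
      have hij' : ((i : ℕ) : ℝ) = ((j : ℕ) : ℝ) := hij
      exact Fin.ext (by exact_mod_cast hij')
    · rw [heval, heval, h]
  -- The values at 0, …, m-1 determine a monic polynomial of degree m and hence its ordered roots. A
  -- continuous injective map on a Borel set is a measurable embedding (Lusin–Souslin), so its
  -- inverse extends measurably and continuity of the roots is not needed.
  have hemb := ContinuousOn.measurableEmbedding hDm
    (show Continuous e by simp only [he]; fun_prop).continuousOn hinj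
  obtain ⟨g, hg, hgc⟩ := hemb.exists_measurable_extend
    (g := fun y : D => (WithLp.toLp 2 (y : Fin m → ℝ) : EuclideanSpace ℝ (Fin m)))
    (by fun_prop) fun _ => ⟨0⟩
  refine ⟨g, hg, fun P h1 h2 h3 => ?_⟩
  obtain ⟨h4, h5⟩ := orderedRoots_spec h1 h2 h3
  have h6 := congr_fun hgc ⟨_, h4⟩
  simp only [Function.comp_apply, Set.domRestrict_apply] at h6
  rw [show (fun i : Fin m => P.eval (i : ℝ)) = e fun k => orderedRoots P m k by
    ext i; rw [← heval, ← h5], h6]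

/-! ### Perturbation of simple roots -/

lemma exists_separation {m : ℕ} {x : Fin m → ℝ} (hx : StrictAnti x) {ε : ℝ} (hε : 0 < ε) :
    ∃ δ, 0 < δ ∧ δ ≤ ε ∧ ∀ k l, k < l → 2 * δ ≤ x k - x l := by
  have h1 : ∀ᶠ δ in 𝓝[>] (0 : ℝ), ∀ k l, k < l → 2 * δ ≤ x k - x l := by
    refine eventually_all.2 fun k => eventually_all.2 fun l => ?_
    by_cases hkl : k < l
    · have h2 : 0 < (x k - x l) / 2 := by linarith [hx hkl]
      filter_upwards [Ioo_mem_nhdsGT h2] with δ hδ _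
      linarith [hδ.2]
    · exact Eventually.of_forall fun δ h => absurd h hkl
  obtain ⟨δ, h3, h4, h5⟩ := (h1.and (Ioc_mem_nhdsGT hε)).exists
  exact ⟨δ, h4, h5, h3⟩

/-- Ordered roots converge as soon as the polynomials become small at the limit points. -/
lemma tendsto_roots {m : ℕ} {x : Fin m → ℝ} (hx : StrictAnti x) {y : ℕ → Fin m → ℝ}
    (hy : ∀ᶠ n in atTop, Antitone (y n))
    (h : ∀ k, Tendsto (fun n => ∏ l, (x k - y n l)) atTop (𝓝 0)) (k : Fin m) :
    Tendsto (fun n => y n k) atTop (𝓝 (x k)) := by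
  refine Metric.tendsto_nhds.2 fun ε hε => ?_
  obtain ⟨δ, hδ, hδε, hsep⟩ := exists_separation hx hε
  have h1 : ∀ᶠ n in atTop, ∀ k, |∏ l, (x k - y n l)| < δ ^ m := by
    refine eventually_all.2 fun k => ?_
    have := (Metric.tendsto_nhds.1 (h k)) (δ ^ m) (by positivity)
    filter_upwards [this] with n hn
    rwa [dist_zero_right, Real.norm_eq_abs] at hn
  filter_upwards [h1, hy] with n hn hyn
  -- A product below δ^m has a factor below δ, so each x_k has some y_l within δ. Since the x_k are
  -- at least 2δ apart, the choice of l is strictly increasing in k, and a strictly increasing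
  -- self-map of `Fin m` is the identity.
  have h2 : ∀ k, ∃ l, |x k - y n l| < δ := by
    intro k
    by_contra! hcon
    have := hn k
    rw [Finset.abs_prod] at this
    have h3 : ∏ _l : Fin m, δ ≤ ∏ l, |x k - y n l| :=
      Finset.prod_le_prod (fun _ _ => hδ.le) fun l _ => hcon l
    simp at h3
    linarith
  choose l hl using h2
  have hmono : StrictMono l := by
    intro i j hij
    have h3 := hsep i j hij
    have h4 := abs_lt.1 (hl i)
    have h5 := abs_lt.1 (hl j)
    by_contra hcon
    have := hyn (not_lt.1 hcon)
    linarith [h4.2, h5.1]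
  have hid : l = id := by
    have hsurj : Function.Surjective l := Finite.surjective_of_injective hmono.injective
    exact (hmono.range_inj strictMono_id).1 (by simp [hsurj.range_eq])
  have := hl k
  rw [hid] at this
  rw [dist_comm, Real.dist_eq]
  exact this.trans_le hδε

/-- First-order perturbation of simple roots. -/
lemma tendsto_scaled_roots {m : ℕ} {x : Fin m → ℝ} (hx : StrictAnti x) {y : ℕ → Fin m → ℝ}
    (hy : ∀ᶠ n in atTop, Antitone (y n)) {r : ℕ → ℝ} (hr : Tendsto r atTop atTop) {q : Fin m → ℝ}
    (h : ∀ k, Tendsto (fun n => r n * ∏ l, (x k - y n l)) atTop (𝓝 (q k))) (k : Fin m) :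
    Tendsto (fun n => r n * (y n k - x k)) atTop
      (𝓝 (-q k / ∏ l ∈ Finset.univ.erase k, (x k - x l))) := by
  have hlim : ∀ k, Tendsto (fun n => y n k) atTop (𝓝 (x k)) := by
    refine tendsto_roots hx hy fun k => ?_
    have h1 := hr.inv_tendsto_atTop.mul (h k)
    rw [zero_mul] at h1
    refine h1.congr' ?_
    filter_upwards [hr.eventually_gt_atTop 0] with n hn
    simp only [Pi.inv_apply]
    rw [inv_mul_cancel_left₀ hn.ne']
  have hprod : Tendsto (fun n => ∏ l ∈ Finset.univ.erase k, (x k - y n l)) atTop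
      (𝓝 (∏ l ∈ Finset.univ.erase k, (x k - x l))) :=
    tendsto_finsetProd _ fun l _ => tendsto_const_nhds.sub (hlim l)
  have hne : ∏ l ∈ Finset.univ.erase k, (x k - x l) ≠ 0 :=
    Finset.prod_ne_zero_iff.2 fun l hl =>
      sub_ne_zero.2 fun h => (Finset.ne_of_mem_erase hl) (hx.injective h).symm
  -- The exact identity y_k - x_k = -∏_l (x_k - y_l) / ∏_{l≠k} (x_k - y_l) is used.
  refine ((h k).neg.div hprod hne).congr' ?_
  filter_upwards [hprod.eventually_ne hne] with n hn
  rw [Pi.div_apply, ← Finset.mul_prod_erase Finset.univ _ (Finset.mem_univ k)]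
  field_simp
  ring

/-! ### Linearization at vanishing Verblunsky coefficients -/

lemma szego_zero_coeff (k : ℕ) : szego 0 k = X ^ k ∧ szegoRev 0 k = 1 := by
  induction k with
  | zero => simp
  | succ k ih => rw [szego_succ, szegoRev_succ, ih.1, ih.2]; simp [pow_succ']

/-- At a = 0 one has Φ_k = X^k and Φ*_k = 1, so the first-order term of Φ_{k+1} is X times that of
Φ_k, minus s_k. The derivative of Φ*_k is multiplied by a_k = 0, so its mere existence suffices. -/
lemma hasDerivAt_szego_coeff (s : ℕ → ℝ) (k : ℕ) : ∀ i,
    HasDerivAt (fun ε : ℝ => (szego (ε • s) k).coeff i) (if i < k then -s (k - 1 - i) else 0) 0 ∧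
      ∃ d, HasDerivAt (fun ε : ℝ => (szegoRev (ε • s) k).coeff i) d 0 := by
  induction k with
  | zero =>
    intro i
    simp only [szego_zero, szegoRev_zero, not_lt_zero, if_false]
    exact ⟨hasDerivAt_const _ _, 0, hasDerivAt_const _ _⟩
  | succ k ih =>
    have hX : ∀ i, HasDerivAt (fun ε : ℝ => (X * szego (ε • s) k).coeff i)
        (if 0 < i ∧ i < k + 1 then -s (k - i) else 0) 0 := by
      intro i
      cases i with
      | zero => simp only [coeff_X_mul_zero]; simpa using hasDerivAt_const _ _
      | succ i =>
        simp only [coeff_X_mul]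
        refine (ih i).1.congr_deriv ?_
        simp only [Nat.succ_pos, true_and, Nat.add_lt_add_iff_right]
        congr 3
        omega
    have hs : HasDerivAt (fun ε : ℝ => (ε • s) k) (s k) 0 := by
      simpa using (hasDerivAt_id (0 : ℝ)).mul_const (s k)
    intro i
    obtain ⟨d, hd⟩ := (ih i).2
    simp only [szego_succ, szegoRev_succ, coeff_sub, coeff_C_mul]
    constructor
    · refine ((hX i).sub (hs.mul hd)).congr_deriv ?_
      have h0 : (szegoRev ((0 : ℝ) • s) k).coeff i = if i = 0 then 1 else 0 := by
        rw [zero_smul, (szego_zero_coeff k).2, coeff_one]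
      rw [h0]
      rcases Nat.eq_zero_or_pos i with rfl | hi
      · simp
      · simp [hi, hi.ne']
    · exact ⟨_, hd.sub (hs.mul (hX i))⟩

/-- The first-order change of the orthogonal polynomial. -/
lemma hasDerivAt_verblunskyPoly (s : ℕ → ℝ) {m : ℕ} (hm : 1 ≤ m) (x : ℝ) :
    HasDerivAt (fun ε : ℝ => (verblunskyPoly (ε • s) m).eval x)
      (-((2 ^ (2 * m - 1))⁻¹ * ∑ j ∈ Finset.range (2 * m - 1),
        s j * (shiftedT (m - 1 - j)).eval x)) 0 := by
  simp only [verblunskyPoly, eval_mul, eval_C, eval_finsetSum]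
  have h1 : HasDerivAt (fun ε : ℝ => ∑ i ∈ Finset.range (2 * m),
      (szego (ε • s) (2 * m - 1)).coeff i * (shiftedT ((i : ℤ) + 1 - m)).eval x)
      (∑ i ∈ Finset.range (2 * m), (if i < 2 * m - 1 then -s (2 * m - 1 - 1 - i) else 0) *
        (shiftedT ((i : ℤ) + 1 - m)).eval x) 0 :=
    HasDerivAt.fun_sum fun i _ => (hasDerivAt_szego_coeff s (2 * m - 1) i).1.mul_const _
  refine (h1.const_mul ((2 ^ (2 * m - 1) : ℝ)⁻¹)).congr_deriv ?_
  rw [show Finset.range (2 * m) = Finset.range (2 * m - 1 + 1) by congr 1; omega,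
    Finset.sum_range_succ, if_neg (lt_irrefl _), zero_mul, add_zero, ← mul_neg,
    ← Finset.sum_range_reflect, ← Finset.sum_neg_distrib]
  congr 1
  refine Finset.sum_congr rfl fun i hi => ?_
  have := Finset.mem_range.1 hi
  rw [if_pos (by omega), neg_mul, show 2 * m - 1 - 1 - (2 * m - 1 - 1 - i) = i by omega,
    show ((2 * m - 1 - 1 - i : ℕ) : ℤ) + 1 - m = m - 1 - i by omega]

/-! ### The limit points -/

/-- The angles `(2k + 1)π / (2m)` of the zeros of the Chebyshev polynomial. -/
def chebAngle (m k : ℕ) : ℝ := (2 * ((k : ℕ) + 1 : ℝ) - 1) * (Real.pi / (2 * m))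

lemma chebRoots_apply {m : ℕ} (k : Fin m) :
    chebRoots m k = (Real.cos (chebAngle m k) + 1) / 2 := rfl

lemma chebAngle_mem {m : ℕ} (k : Fin m) : chebAngle m k ∈ Set.Ioo 0 Real.pi := by
  have hm : 0 < (m : ℝ) := by exact_mod_cast k.pos
  have hk : ((k : ℕ) : ℝ) + 1 ≤ m := by exact_mod_cast k.2
  have hpi := Real.pi_pos
  have h0 : (0 : ℝ) ≤ (k : ℕ) := by positivity
  unfold chebAngle
  constructor
  · have : 0 < 2 * (((k : ℕ) : ℝ) + 1) - 1 := by linarith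
    positivity
  · rw [← mul_div_assoc, div_lt_iff₀ (by positivity)]
    nlinarith

lemma mul_chebAngle {m : ℕ} (k : Fin m) :
    m * chebAngle m k = (k : ℕ) * Real.pi + Real.pi / 2 := by
  have hm : (m : ℝ) ≠ 0 := by exact_mod_cast k.pos.ne'
  unfold chebAngle
  field_simp
  ring

lemma cos_mul_chebAngle {m : ℕ} (k : Fin m) : Real.cos (m * chebAngle m k) = 0 := by
  rw [mul_chebAngle, Real.cos_add_pi_div_two, Real.sin_nat_mul_pi, neg_zero]

lemma sin_mul_chebAngle_ne_zero {m : ℕ} (k : Fin m) : Real.sin (m * chebAngle m k) ≠ 0 := by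
  intro h
  have := Real.sin_sq_add_cos_sq (m * chebAngle m k)
  rw [h, cos_mul_chebAngle] at this
  norm_num at this

lemma sin_chebAngle_pos {m : ℕ} (k : Fin m) : 0 < Real.sin (chebAngle m k) :=
  Real.sin_pos_of_mem_Ioo (chebAngle_mem k)

lemma chebRoots_strictAnti (m : ℕ) : StrictAnti fun k => chebRoots m k := by
  intro i j hij
  have h : chebAngle m i < chebAngle m j := by
    have hm : 0 < (m : ℝ) := by exact_mod_cast i.pos
    have : ((i : ℕ) : ℝ) < (j : ℕ) := by exact_mod_cast hij
    have hpi := Real.pi_pos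
    unfold chebAngle
    gcongr
  have := Real.strictAntiOn_cos (Set.Ioo_subset_Icc_self (chebAngle_mem i))
    (Set.Ioo_subset_Icc_self (chebAngle_mem j)) h
  simp only [chebRoots_apply]
  linarith

lemma verblunskyPoly_zero {m : ℕ} (hm : 1 ≤ m) :
    verblunskyPoly 0 m = C (2 ^ (2 * m - 1) : ℝ)⁻¹ * shiftedT m := by
  rw [verblunskyPoly, (szego_zero_coeff _).1, Finset.sum_eq_single (2 * m - 1)]
  · rw [coeff_X_pow_self, C_1, one_mul]
    congr 3
    omega
  · intro i _ hi
    rw [coeff_X_pow, if_neg hi, C_0, zero_mul]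
  · intro h
    exact absurd (Finset.mem_range.2 (by omega)) h

lemma verblunskyPoly_zero_eq_prod {m : ℕ} (hm : 1 ≤ m) :
    verblunskyPoly 0 m = ∏ k : Fin m, (X - C (chebRoots m k)) := by
  refine eq_of_eval_eq (ι := Fin m) (verblunskyPoly_monic 0 hm) (monic_prod_X_sub_C _)
    (by rw [verblunskyPoly_natDegree 0 hm, Fintype.card_fin])
    (by rw [natDegree_prod_X_sub_C, Fintype.card_fin]) (chebRoots_strictAnti m).injective
    fun k => ?_
  rw [verblunskyPoly_zero hm, eval_mul, chebRoots_apply, shiftedT_eval_cos, eval_prod,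
    Finset.prod_eq_zero (Finset.mem_univ k) (by rw [chebRoots_apply]; simp)]
  rw [Int.cast_natCast, cos_mul_chebAngle, mul_zero]

/-- The product is the derivative at x_k of the monic multiple of T_m. It follows from T_m' = m
U_{m-1} and U_{m-1}(cos θ) sin θ = sin(mθ); the factor 2 is the inner derivative of 2x - 1. -/
lemma prod_erase_chebRoots {m : ℕ} (hm : 1 ≤ m) (k : Fin m) :
    ∏ l ∈ Finset.univ.erase k, (chebRoots m k - chebRoots m l) =
      (2 ^ (2 * m - 1))⁻¹ * (2 * m * Real.sin (m * chebAngle m k) / Real.sin (chebAngle m k)) := by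
  have h1 := Lagrange.eval_nodal_derivative_eval_node_eq (s := Finset.univ)
    (v := fun l => chebRoots m l) (Finset.mem_univ k)
  rw [Lagrange.nodal, ← verblunskyPoly_zero_eq_prod hm, Lagrange.eval_nodal] at h1
  rw [← h1, verblunskyPoly_zero hm, derivative_C_mul, eval_mul, eval_C, shiftedT, derivative_comp,
    Chebyshev.T_derivative_eq_U]
  congr 1
  have h2 := Chebyshev.U_real_cos (chebAngle m k) (m - 1)
  have hs := (sin_chebAngle_pos k).ne'
  have h3 : eval (chebRoots m k) (2 * X - 1) = Real.cos (chebAngle m k) := by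
    rw [chebRoots_apply]; simp; ring
  simp only [eval_mul, eval_comp, h3]
  push_cast at h2
  rw [sub_add_cancel] at h2
  rw [← h2]
  field_simp
  simp
  ring

/-- The derivative of the root vector with respect to the Verblunsky coefficients. -/
def rootJacobian (m : ℕ) : Matrix (Fin m) (Fin (2 * m - 1)) ℝ :=
  Matrix.of fun k j => Real.sin (chebAngle m k) * Real.sin (((j : ℕ) + 1) * chebAngle m k) / m

/-- Directional linearization of the root vector at vanishing Verblunsky coefficients. -/
lemma tendsto_scaled_orderedRoots {m : ℕ} (hm : 1 ≤ m) (s : Fin (2 * m - 1) → ℝ) :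
    Tendsto (fun n : ℕ => (4 * √(n : ℝ)) •
      (orderedRoots (verblunskyPoly (extend ((2 * √(n : ℝ))⁻¹ • s)) m) m - chebRoots m)) atTop
      (𝓝 (WithLp.toLp 2 ((rootJacobian m).mulVec s))) := by
  set ε : ℕ → ℝ := fun n => (2 * √(n : ℝ))⁻¹ with hε
  have hsqrt : Tendsto (fun n : ℕ => 2 * √(n : ℝ)) atTop atTop :=
    (Real.tendsto_sqrt_atTop.comp tendsto_natCast_atTop_atTop).const_mul_atTop two_pos
  have hε0 : Tendsto ε atTop (𝓝 0) := hsqrt.inv_tendsto_atTop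
  have hεpos : ∀ᶠ n in atTop, 0 < ε n := by
    filter_upwards [hsqrt.eventually_gt_atTop 0] with n hn using inv_pos.2 hn
  have hext : ∀ n, extend (ε n • s) = ε n • extend s := by
    intro n; ext k
    simp only [extend, Pi.smul_apply, smul_eq_mul]
    split_ifs <;> simp
  -- Inside the open cube the polynomial belongs to an actual measure, which guarantees that it
  -- splits.
  have hcube : ∀ᶠ n in atTop, ε n • s ∈ openCube (2 * m - 1) := by
    have h1 : Tendsto (fun n => ε n • s) atTop (𝓝 ((0 : ℝ) • s)) := hε0.smul_const s
    rw [zero_smul] at h1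
    refine h1.eventually (IsOpen.mem_nhds ?_ ?_)
    · exact isOpen_set_pi Set.finite_univ fun _ _ => isOpen_Ioo
    · intro i _; simp
  set p : ℕ → ℝ[X] := fun n => verblunskyPoly (extend (ε n • s)) m with hp
  set y : ℕ → Fin m → ℝ := fun n k => orderedRoots (p n) m k with hy
  have hspec : ∀ᶠ n in atTop, Antitone (y n) ∧ p n = ∏ k, (X - C (y n k)) := by
    filter_upwards [hcube] with n hn
    exact orderedRoots_spec (verblunskyPoly_monic _ hm) (verblunskyPoly_natDegree _ hm)
      (orthPoly_momentMap hm (by omega) hn).2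
  have hr : Tendsto (fun n : ℕ => 4 * √(n : ℝ)) atTop atTop :=
    (Real.tendsto_sqrt_atTop.comp tendsto_natCast_atTop_atTop).const_mul_atTop four_pos
  set q : Fin m → ℝ := fun k => 2 * (-((2 ^ (2 * m - 1))⁻¹ * ∑ j ∈ Finset.range (2 * m - 1),
    extend s j * (shiftedT (m - 1 - j)).eval (chebRoots m k))) with hq
  have hpq : ∀ k, Tendsto (fun n : ℕ => 4 * √(n : ℝ) * ∏ l, (chebRoots m k - y n l)) atTop
      (𝓝 (q k)) := by
    intro k
    have hd := hasDerivAt_verblunskyPoly (extend s) hm (chebRoots m k)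
    have h0 : (verblunskyPoly ((0 : ℝ) • extend s) m).eval (chebRoots m k) = 0 := by
      rw [zero_smul, verblunskyPoly_zero_eq_prod hm, eval_prod]
      exact Finset.prod_eq_zero (Finset.mem_univ k) (by simp)
    have h1 := (hasDerivAt_iff_tendsto_slope_zero.1 hd)
    have h2 : Tendsto ε atTop (𝓝[≠] 0) :=
      tendsto_nhdsWithin_iff.2 ⟨hε0, hεpos.mono fun n hn => hn.ne'⟩
    -- Since ε = 1/(2√n), the scale 4√n is 2/ε and the scaled value is twice a difference quotient.
    have h3 := (h1.comp h2).const_mul 2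
    refine h3.congr' ?_
    filter_upwards [hspec] with n hn
    simp only [Function.comp_apply, zero_add, h0, sub_zero, smul_eq_mul]
    rw [← hext, show verblunskyPoly (extend (ε n • s)) m = p n from rfl, hn.2, eval_prod]
    simp only [eval_sub, eval_X, eval_C, hε, inv_inv]
    ring
  have key := tendsto_scaled_roots (chebRoots_strictAnti m) (hspec.mono fun n hn => hn.1) hr hpq
  have hval : ∀ k, -q k / ∏ l ∈ Finset.univ.erase k, (chebRoots m k - chebRoots m l) =
      (rootJacobian m).mulVec s k := by
    intro k
    have hs0 := (sin_chebAngle_pos k).ne'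
    have hs1 := sin_mul_chebAngle_ne_zero k
    have hm0 : (m : ℝ) ≠ 0 := by exact_mod_cast (by omega : m ≠ 0)
    -- Because cos(mθ) = 0, the addition formula leaves only the sine term; its factor sin(mθ)
    -- cancels against the one in the product of root differences.
    have hterm : ∀ j : Fin (2 * m - 1), (shiftedT (m - 1 - (j : ℕ))).eval (chebRoots m k) =
        Real.sin (m * chebAngle m k) * Real.sin (((j : ℕ) + 1) * chebAngle m k) := by
      intro j
      rw [chebRoots_apply, shiftedT_eval_cos]
      have : (((m : ℤ) - 1 - (j : ℕ) : ℤ) : ℝ) * chebAngle m k =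
          m * chebAngle m k - ((j : ℕ) + 1) * chebAngle m k := by push_cast; ring
      rw [this, Real.cos_sub, cos_mul_chebAngle, zero_mul, zero_add]
    rw [prod_erase_chebRoots hm, hq]
    simp only
    rw [Finset.sum_range fun j => extend s j * (shiftedT (m - 1 - j)).eval (chebRoots m k)]
    simp_rw [hterm, extend_fin]
    rw [Matrix.mulVec, dotProduct]
    simp only [rootJacobian, Matrix.of_apply]
    have hfac : ∑ j : Fin (2 * m - 1), s j * (Real.sin (m * chebAngle m k) *
        Real.sin (((j : ℕ) + 1) * chebAngle m k)) = Real.sin (m * chebAngle m k) *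
          ∑ j : Fin (2 * m - 1), s j * Real.sin (((j : ℕ) + 1) * chebAngle m k) := by
      rw [Finset.mul_sum]
      exact Finset.sum_congr rfl fun j _ => by ring
    have hfac2 : ∑ j : Fin (2 * m - 1), Real.sin (chebAngle m k) *
        Real.sin (((j : ℕ) + 1) * chebAngle m k) / m * s j = Real.sin (chebAngle m k) / m *
          ∑ j : Fin (2 * m - 1), s j * Real.sin (((j : ℕ) + 1) * chebAngle m k) := by
      rw [Finset.mul_sum]
      exact Finset.sum_congr rfl fun j _ => by ring
    rw [hfac, hfac2]
    field_simp
  simp_rw [hval] at key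
  have h4 : Tendsto (fun n : ℕ => fun k => 4 * √(n : ℝ) * (y n k - chebRoots m k)) atTop
      (𝓝 ((rootJacobian m).mulVec s)) := tendsto_pi_nhds.2 key
  exact ((PiLp.continuous_toLp 2 _).tendsto _).comp h4

end RandomOrthPoly
end

noncomputable section

namespace RandomOrthPoly

/-! ### The limiting covariance matrix -/

lemma chebT_chebRoots {m : ℕ} (k : Fin m) (j : ℕ) :
    chebT j (chebRoots m k) = Real.cos (j * chebAngle m k) := by
  have h := chebAngle_mem k
  rw [chebT, chebRoots_apply, mul_div_cancel₀ _ (two_ne_zero' ℝ), add_sub_cancel_right,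
    Real.arccos_cos h.1.le h.2.le]

lemma sum_Icc_eq_sum_range (f : ℕ → ℝ) (a b : ℕ) :
    ∑ j ∈ Finset.Icc a b, f j = ∑ i ∈ Finset.range (b + 1 - a), f (a + i) := by
  rw [← Finset.sum_Ico_eq_sum_range]
  congr 1

lemma sum_range_two_mul_add_one (f : ℕ → ℝ) (M : ℕ) : ∑ j ∈ Finset.range (2 * M + 1), f j =
    ∑ i ∈ Finset.range (M + 1), f (2 * i) + ∑ i ∈ Finset.range M, f (2 * i + 1) := by
  induction M with
  | zero => simp
  | succ M ih =>
    rw [show 2 * (M + 1) + 1 = 2 * M + 1 + 1 + 1 by ring, Finset.sum_range_succ,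
      Finset.sum_range_succ, ih, Finset.sum_range_succ (fun i => f (2 * i)) (M + 1),
      Finset.sum_range_succ (fun i => f (2 * i + 1)) M]
    rw [show 2 * (M + 1) = 2 * M + 1 + 1 by ring]
    ring

/-- The end terms are kept apart: in the covariance the upper ones vanish since cos(mθ) = 0, and the
lower ones become the isolated terms 1/4 and T_1 T_1 / 4 of γ. -/
lemma sum_range_sub_mul_sub (u v : ℕ → ℝ) (M : ℕ) :
    ∑ i ∈ Finset.range (M + 1), (u i - u (i + 1)) * (v i - v (i + 1)) =
      u 0 * v 0 + 2 * ∑ i ∈ Finset.range M, u (i + 1) * v (i + 1) + u (M + 1) * v (M + 1)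
        - ∑ i ∈ Finset.range (M + 1), (u i * v (i + 1) + v i * u (i + 1)) := by
  induction M with
  | zero => simp; ring
  | succ M ih =>
    rw [Finset.sum_range_succ, ih, Finset.sum_range_succ (fun i => u (i + 1) * v (i + 1)) M,
      Finset.sum_range_succ (fun i => u i * v (i + 1) + v i * u (i + 1)) (M + 1)]
    ring

lemma sin_mul_sin_odd (θ : ℝ) (i : ℕ) : Real.sin θ * Real.sin (((2 * i : ℕ) + 1) * θ) =
    Real.cos (i * θ) ^ 2 - Real.cos ((i + 1 : ℕ) * θ) ^ 2 := by
  have h1 : ((i + 1 : ℕ) : ℝ) * θ = i * θ + θ := by push_cast; ring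
  have h2 : (((2 * i : ℕ) : ℝ) + 1) * θ = i * θ + (i * θ + θ) := by push_cast; ring
  rw [h1, h2, Real.sin_add, Real.sin_add, Real.cos_add]
  linear_combination (Real.cos (i * θ) ^ 2) * Real.sin_sq_add_cos_sq θ

lemma sin_mul_sin_even (θ : ℝ) (i : ℕ) : Real.sin θ * Real.sin (((2 * i + 1 : ℕ) + 1) * θ) =
    Real.cos (i * θ) * Real.cos ((i + 1 : ℕ) * θ) -
      Real.cos ((i + 1 : ℕ) * θ) * Real.cos ((i + 1 + 1 : ℕ) * θ) := by
  have h1 : (i : ℝ) * θ = (i + 1 : ℕ) * θ - θ := by push_cast; ring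
  have h2 : ((i + 1 + 1 : ℕ) : ℝ) * θ = (i + 1 : ℕ) * θ + θ := by push_cast; ring
  have h3 : (((2 * i + 1 : ℕ) : ℝ) + 1) * θ = 2 * ((i + 1 : ℕ) * θ) := by push_cast; ring
  rw [h1, h2, h3, Real.cos_sub, Real.cos_add, Real.sin_two_mul]
  ring

/-- In J Jᵀ the summation index is split by parity. Odd multiples turn sin θ sin((2i+1)θ) into a
difference of squared cosines, even multiples give a difference of products of neighbouring cosines.
Multiplying out yields the two groups of terms in γ. -/
lemma limitCov_eq {m : ℕ} (hm : 1 ≤ m) :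
    limitCov m = rootJacobian m * (rootJacobian m).transpose := by
  obtain ⟨M, rfl⟩ : ∃ M, m = M + 1 := ⟨m - 1, by omega⟩
  ext k l
  set c : ℕ → ℝ := fun j => Real.cos (j * chebAngle (M + 1) k) with hc
  set e : ℕ → ℝ := fun j => Real.cos (j * chebAngle (M + 1) l) with he
  have hc0 : c 0 = 1 := by simp [hc]
  have he0 : e 0 = 1 := by simp [he]
  have hcM : c (M + 1) = 0 := cos_mul_chebAngle k
  have heM : e (M + 1) = 0 := cos_mul_chebAngle l
  have hm0 : ((M + 1 : ℕ) : ℝ) ≠ 0 := by positivity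
  have hR : (rootJacobian (M + 1) * (rootJacobian (M + 1)).transpose) k l =
      (((M + 1 : ℕ) : ℝ) ^ 2)⁻¹ *
        (∑ i ∈ Finset.range (M + 1), (c i ^ 2 - c (i + 1) ^ 2) * (e i ^ 2 - e (i + 1) ^ 2) +
          ∑ i ∈ Finset.range M, (c i * c (i + 1) - c (i + 1) * c (i + 1 + 1)) *
            (e i * e (i + 1) - e (i + 1) * e (i + 1 + 1))) := by
    rw [Matrix.mul_apply]
    simp only [rootJacobian, Matrix.transpose_apply, Matrix.of_apply]
    rw [← Finset.sum_range fun j : ℕ => Real.sin (chebAngle (M + 1) k) *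
      Real.sin ((j + 1) * chebAngle (M + 1) k) / ((M + 1 : ℕ) : ℝ) * (Real.sin (chebAngle (M + 1) l) *
        Real.sin ((j + 1) * chebAngle (M + 1) l) / ((M + 1 : ℕ) : ℝ)),
      show 2 * (M + 1) - 1 = 2 * M + 1 by omega, sum_range_two_mul_add_one, mul_add,
      Finset.mul_sum, Finset.mul_sum]
    congr 1
    · refine Finset.sum_congr rfl fun i _ => ?_
      rw [sin_mul_sin_odd, sin_mul_sin_odd]
      simp only [hc, he]
      field_simp
    · refine Finset.sum_congr rfl fun i _ => ?_
      rw [sin_mul_sin_even, sin_mul_sin_even]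
      simp only [hc, he]
      field_simp
  have h1 := sum_range_sub_mul_sub (fun i => c i ^ 2) (fun i => e i ^ 2) M
  rw [Finset.sum_range_succ (fun i => c i ^ 2 * e (i + 1) ^ 2 + e i ^ 2 * c (i + 1) ^ 2)] at h1
  simp only [hc0, he0, hcM, heM] at h1
  have h2 : ∑ i ∈ Finset.range M, (c i * c (i + 1) - c (i + 1) * c (i + 1 + 1)) *
      (e i * e (i + 1) - e (i + 1) * e (i + 1 + 1)) = c 1 * e 1 +
        2 * ∑ i ∈ Finset.range (M - 1), c (i + 1) * c (i + 2) * e (i + 1) * e (i + 2) -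
        ∑ i ∈ Finset.range (M - 1), (c i * c (i + 1) * e (i + 1) * e (i + 2) +
          e i * e (i + 1) * c (i + 1) * c (i + 2)) := by
    cases M with
    -- For m = 1 the left sum is empty, and the isolated term vanishes because the only angle is
    -- π/2.
    | zero => simp only [zero_add] at hcM; simp [hcM]
    | succ M =>
      have h3 := sum_range_sub_mul_sub (fun i => c i * c (i + 1)) (fun i => e i * e (i + 1)) M
      rw [Finset.sum_range_succ (fun i => c i * c (i + 1) * (e (i + 1) * e (i + 1 + 1)) +
        e i * e (i + 1) * (c (i + 1) * c (i + 1 + 1)))] at h3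
      simp only [hc0, he0, hcM, heM, zero_add, one_mul, mul_zero, add_zero] at h3
      rw [h3, add_tsub_cancel_right]
      congr 1
      · congr 2
        exact Finset.sum_congr rfl fun i _ => by ring
      · exact Finset.sum_congr rfl fun i _ => by ring
  have b1 : ∀ j : ℕ, Real.cos (j * chebAngle (M + 1) k) = c j := fun _ => rfl
  have b2 : ∀ j : ℕ, Real.cos (j * chebAngle (M + 1) l) = e j := fun _ => rfl
  have reindex : ∀ (f g : ℕ → ℝ) (a b M' : ℕ), b + 1 - a = M' → (∀ i, f (a + i) = g i) →
      ∑ j ∈ Finset.Icc a b, f j = ∑ i ∈ Finset.range M', g i := by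
    rintro f g a b _ rfl h
    rw [sum_Icc_eq_sum_range]
    exact Finset.sum_congr rfl fun i _ => h i
  have t1 : ∀ i, 2 + i - 1 = i + 1 := fun i => by omega
  have t2 : ∀ i, i + 2 - 1 = i + 1 := fun i => by omega
  rw [hR, h1, h2, limitCov, Matrix.of_apply, gammaFun]
  simp only [chebT_chebRoots, b1, b2]
  rw [reindex _ (fun i => c (i + 1) ^ 2 * e (i + 1) ^ 2) 2 (M + 1) M (by omega)
      fun i => by simp only [t1],
    reindex _ (fun i => c i ^ 2 * e (i + 1) ^ 2 + e i ^ 2 * c (i + 1) ^ 2) 1 (M + 1 - 1) M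
      (by omega) fun i => by simp only [add_comm 1 i, add_tsub_cancel_right],
    reindex _ (fun i => c (i + 1) * c (i + 2) * e (i + 1) * e (i + 2)) 2 (M + 1 - 1) (M - 1)
      (by omega) fun i => by simp only [add_comm 2 i, t2],
    reindex _ (fun i => c i * c (i + 1) * e (i + 1) * e (i + 2) +
        e i * e (i + 1) * c (i + 1) * c (i + 2)) 1 (M + 1 - 2) (M - 1)
      (by omega) fun i => by
        simp only [add_comm 1 i, add_assoc, one_add_one_eq_two, add_tsub_cancel_right]]
  field_simp
  ring

lemma limitCov_posSemidef {m : ℕ} (hm : 1 ≤ m) : (limitCov m).PosSemidef := by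
  rw [limitCov_eq hm, ← Matrix.conjTranspose_eq_transpose_of_trivial]
  exact Matrix.posSemidef_self_mul_conjTranspose _

/-- Linear images of a standard Gaussian vector. -/
lemma map_mulVec_pi_gaussianReal {ι κ : Type*} [Fintype ι] [Fintype κ] [DecidableEq ι]
    (A : Matrix ι κ ℝ) :
    (Measure.pi fun _ : κ => gaussianReal 0 1).map
        (fun s => (WithLp.toLp 2 (A.mulVec s) : EuclideanSpace ℝ ι)) =
      multivariateGaussian 0 (A * A.transpose) := by
  have hpsd : (A * A.transpose).PosSemidef := by
    rw [← Matrix.conjTranspose_eq_transpose_of_trivial]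
    exact Matrix.posSemidef_self_mul_conjTranspose _
  have hmeas : Measurable fun s : κ → ℝ => (WithLp.toLp 2 (A.mulVec s) : EuclideanSpace ℝ ι) := by
    refine (PiLp.continuous_toLp 2 _).measurable.comp ?_
    exact (Continuous.matrix_mulVec continuous_const continuous_id).measurable
  have hprob := Measure.isProbabilityMeasure_map
    (μ := Measure.pi fun _ : κ => gaussianReal 0 1) hmeas.aemeasurable
  -- By ⟨As, t⟩ = ⟨s, Aᵀt⟩ the characteristic function is the standard Gaussian one at Aᵀt, and
  -- |Aᵀt|² = t · (AAᵀ)t.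
  refine Measure.ext_of_charFun (E := EuclideanSpace ℝ ι) ?_
  ext t
  have hstd := charFun_stdGaussian (E := EuclideanSpace ℝ κ)
    (WithLp.toLp 2 (A.transpose.mulVec t.ofLp))
  rw [← map_pi_eq_stdGaussian, charFun_apply, integral_map (by fun_prop) (by fun_prop)] at hstd
  rw [charFun_multivariateGaussian hpsd, charFun_apply, integral_map hmeas.aemeasurable
    (by fun_prop)]
  have hin : ∀ s : κ → ℝ, inner ℝ (WithLp.toLp 2 (A.mulVec s) : EuclideanSpace ℝ ι) t =
      inner ℝ (WithLp.toLp 2 s : EuclideanSpace ℝ κ)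
        (WithLp.toLp 2 (A.transpose.mulVec t.ofLp)) := by
    intro s
    rw [EuclideanSpace.inner_eq_star_dotProduct, EuclideanSpace.inner_eq_star_dotProduct]
    simp only [star_trivial]
    rw [Matrix.mulVec_transpose, ← Matrix.dotProduct_mulVec]
  simp_rw [hin]
  rw [hstd, inner_zero_right]
  congr 1
  have : ‖(WithLp.toLp 2 (A.transpose.mulVec t.ofLp) : EuclideanSpace ℝ κ)‖ ^ 2 =
      dotProduct t.ofLp ((A * A.transpose).mulVec t.ofLp) := by
    rw [EuclideanSpace.real_norm_sq_eq, ← Matrix.mulVec_mulVec, Matrix.dotProduct_mulVec,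
      ← Matrix.mulVec_transpose, dotProduct]
    exact Finset.sum_congr rfl fun i _ => sq _
  rw [← this]
  push_cast
  ring

/-! ### Rescaled beta densities -/

/-- The density of a rescaled symmetric beta variable, for the `j`-th Verblunsky coefficient of a
uniform moment vector of order `2n - 1`. -/
def scaledDensity (n j : ℕ) (s : ℝ) : ℝ :=
  (2 * √(n : ℝ))⁻¹ * (betaWeight (2 * n - 1 - 1 - j) ((2 * √(n : ℝ))⁻¹ * s) /
    betaMass (2 * n - 1 - 1 - j))

lemma sq_inv_two_mul_sqrt (n : ℕ) : ((2 * √(n : ℝ))⁻¹) ^ 2 = (4 * n : ℝ)⁻¹ := by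
  rw [inv_pow, mul_pow, Real.sq_sqrt (Nat.cast_nonneg n)]; norm_num

lemma tendsto_inv_two_mul_sqrt : Tendsto (fun n : ℕ => (2 * √(n : ℝ))⁻¹) atTop (𝓝 0) :=
  ((Real.tendsto_sqrt_atTop.comp tendsto_natCast_atTop_atTop).const_mul_atTop
    two_pos).inv_tendsto_atTop

/-- The 2n-th power of 1 - s²/(4n) tends to exp(-s²/2), and the 2 + j missing factors tend to 1. For
fixed s the argument eventually lies in the support. -/
lemma tendsto_betaWeight (j : ℕ) (s : ℝ) :
    Tendsto (fun n : ℕ => betaWeight (2 * n - 1 - 1 - j) ((2 * √(n : ℝ))⁻¹ * s)) atTop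
      (𝓝 (Real.exp (-s ^ 2 / 2))) := by
  have h0 : Tendsto (fun n : ℕ => (2 * √(n : ℝ))⁻¹ * s) atTop (𝓝 0) := by
    simpa using tendsto_inv_two_mul_sqrt.mul_const s
  have hu : Tendsto (fun n : ℕ => 1 - ((2 * √(n : ℝ))⁻¹ * s) ^ 2) atTop (𝓝 1) := by
    simpa using (tendsto_const_nhds (x := (1 : ℝ))).sub (h0.pow 2)
  have h1 : Tendsto (fun n : ℕ => ((1 + (-(s ^ 2 / 4)) / (n : ℝ)) ^ n) ^ 2) atTop
      (𝓝 (Real.exp (-(s ^ 2 / 4)) ^ 2)) :=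
    (Real.tendsto_one_add_div_pow_exp (-(s ^ 2 / 4))).pow 2
  have h2 := h1.div (hu.pow (2 + j)) (by simp)
  rw [one_pow, div_one, ← Real.exp_nat_mul] at h2
  have h3 : ((2 : ℕ) : ℝ) * (-(s ^ 2 / 4)) = -s ^ 2 / 2 := by push_cast; ring
  rw [h3] at h2
  refine h2.congr' ?_
  filter_upwards [h0.eventually (Ioo_mem_nhds (neg_one_lt_zero) one_pos), hu.eventually_ne one_ne_zero,
    eventually_ge_atTop (2 + j)] with n hn hne hnj
  rw [betaWeight, Set.indicator_of_mem (show _ ∈ Set.Ioo (-1 : ℝ) 1 from hn), Pi.div_apply]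
  have hn0 : (n : ℝ) ≠ 0 := by
    have : n ≠ 0 := by omega
    exact_mod_cast this
  have h4 : 1 + (-(s ^ 2 / 4)) / (n : ℝ) = 1 - ((2 * √(n : ℝ))⁻¹ * s) ^ 2 := by
    rw [mul_pow, sq_inv_two_mul_sqrt]
    field_simp
    ring
  rw [h4, ← pow_mul, div_eq_iff (pow_ne_zero _ hne), ← pow_add]
  congr 1
  omega

/-- For n ≥ 2 + j the exponent 2n-2-j is at least n, and (1 - x)^n ≤ exp(-nx) with x = s²/(4n). The
bound is uniform in n and serves as the dominating function throughout. -/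
lemma betaWeight_le {n j : ℕ} (hn : 2 + j ≤ n) (s : ℝ) :
    betaWeight (2 * n - 1 - 1 - j) ((2 * √(n : ℝ))⁻¹ * s) ≤ Real.exp (-(1 / 4) * s ^ 2) := by
  by_cases hmem : (2 * √(n : ℝ))⁻¹ * s ∈ Set.Ioo (-1 : ℝ) 1
  · rw [betaWeight, Set.indicator_of_mem hmem]
    have h1 := (sq_lt_one_iff_abs_lt_one _).2 (abs_lt.2 hmem)
    have h2 := Real.add_one_le_exp (-((2 * √(n : ℝ))⁻¹ * s) ^ 2)
    set x := ((2 * √(n : ℝ))⁻¹ * s) ^ 2 with hx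
    have hn0 : (0 : ℝ) < n := by
      have : 0 < n := by omega
      exact_mod_cast this
    have hx2 : x = s ^ 2 / (4 * n) := by
      rw [hx, mul_pow, sq_inv_two_mul_sqrt]; ring
    calc (1 - x) ^ (2 * n - 1 - 1 - j) ≤ (1 - x) ^ n :=
          pow_le_pow_of_le_one (by linarith) (by linarith [sq_nonneg ((2 * √(n : ℝ))⁻¹ * s)])
            (by omega)
      _ ≤ Real.exp (-x) ^ n := by
          refine pow_le_pow_left₀ (by linarith) ?_ _
          have h3 : -((2 * √(n : ℝ))⁻¹ * s) ^ 2 = -x := by rw [hx]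
          linarith [Real.add_one_le_exp (-x)]
      _ = Real.exp (-(1 / 4) * s ^ 2) := by
          rw [← Real.exp_nat_mul, hx2]
          congr 1
          field_simp
  · rw [betaWeight, Set.indicator_of_notMem hmem]
    exact (Real.exp_pos _).le

lemma integrable_exp_quarter : Integrable fun s : ℝ => Real.exp (-(1 / 4) * s ^ 2) :=
  integrable_exp_neg_mul_sq (by norm_num)

lemma integral_betaWeight_scaled {n : ℕ} (hn : 0 < n) (K : ℕ) :
    ∫ s, betaWeight K ((2 * √(n : ℝ))⁻¹ * s) = 2 * √(n : ℝ) * betaMass K := by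
  have : 0 < √(n : ℝ) := Real.sqrt_pos.2 (by exact_mod_cast hn)
  rw [Measure.integral_comp_mul_left (betaWeight K), inv_inv, abs_of_pos (by positivity),
    smul_eq_mul, betaMass]

/-- Integrating the convergence of the weights gives the normalizing constants, without asymptotics
of the beta function. -/
lemma tendsto_betaMass_scaled (j : ℕ) :
    Tendsto (fun n : ℕ => 2 * √(n : ℝ) * betaMass (2 * n - 1 - 1 - j)) atTop
      (𝓝 (√(2 * Real.pi))) := by
  have h1 : Tendsto (fun n : ℕ => ∫ s, betaWeight (2 * n - 1 - 1 - j) ((2 * √(n : ℝ))⁻¹ * s)) atTop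
      (𝓝 (∫ s, Real.exp (-s ^ 2 / 2))) := by
    refine tendsto_integral_filter_of_dominated_convergence
      (fun s => Real.exp (-(1 / 4) * s ^ 2)) ?_ ?_ integrable_exp_quarter ?_
    · exact Eventually.of_forall fun n =>
        ((measurable_betaWeight _).comp (measurable_const_mul _)).aestronglyMeasurable
    · filter_upwards [eventually_ge_atTop (2 + j)] with n hn
      refine ae_of_all _ fun s => ?_
      rw [Real.norm_of_nonneg (betaWeight_nonneg _ _)]
      exact betaWeight_le hn s
    · exact ae_of_all _ fun s => tendsto_betaWeight j s
  have h2 : ∫ s : ℝ, Real.exp (-s ^ 2 / 2) = √(2 * Real.pi) := by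
    have := integral_gaussian (1 / 2)
    rw [show Real.pi / (1 / 2) = 2 * Real.pi by ring] at this
    rw [← this]
    congr with s
    ring_nf
  rw [h2] at h1
  refine h1.congr' ?_
  filter_upwards [eventually_gt_atTop 0] with n hn
  exact integral_betaWeight_scaled hn _

lemma scaledDensity_eq {n : ℕ} (j : ℕ) (s : ℝ) : scaledDensity n j s =
    betaWeight (2 * n - 1 - 1 - j) ((2 * √(n : ℝ))⁻¹ * s) /
      (2 * √(n : ℝ) * betaMass (2 * n - 1 - 1 - j)) := by
  rw [scaledDensity, div_mul_eq_div_div_swap, div_eq_inv_mul _ (2 * √(n : ℝ))]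

lemma tendsto_scaledDensity (j : ℕ) (s : ℝ) :
    Tendsto (fun n : ℕ => scaledDensity n j s) atTop (𝓝 (gaussianPDFReal 0 1 s)) := by
  simp only [scaledDensity_eq]
  have h := (tendsto_betaWeight j s).div (tendsto_betaMass_scaled j)
    (by have := Real.pi_pos; positivity)
  have heq : gaussianPDFReal 0 1 s = Real.exp (-s ^ 2 / 2) / √(2 * Real.pi) := by
    rw [gaussianPDFReal, NNReal.coe_one, mul_one, mul_one, sub_zero]
    exact (div_eq_inv_mul _ _).symm
  rw [heq]
  exact h

/-- The normalizers tend to √(2π) > 1, so eventually dividing by them only decreases the weight. -/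
lemma scaledDensity_le (j : ℕ) : ∀ᶠ n : ℕ in atTop, ∀ s,
    ‖scaledDensity n j s‖ ≤ Real.exp (-(1 / 4) * s ^ 2) := by
  have h1 : (1 : ℝ) < √(2 * Real.pi) := by
    rw [Real.lt_sqrt zero_le_one]
    linarith [Real.pi_gt_three]
  filter_upwards [eventually_ge_atTop (2 + j), (tendsto_betaMass_scaled j).eventually (lt_mem_nhds h1)]
    with n hn hB s
  have h2 := betaWeight_nonneg (2 * n - 1 - 1 - j) ((2 * √(n : ℝ))⁻¹ * s)
  rw [scaledDensity_eq, Real.norm_of_nonneg (div_nonneg h2 (by linarith))]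
  exact (div_le_self h2 hB.le).trans (betaWeight_le hn s)

lemma measurable_scaledDensity (n j : ℕ) : Measurable (scaledDensity n j) :=
  (((measurable_betaWeight _).comp (measurable_const_mul _)).div_const _).const_mul _

/-- The law of the first `d` Verblunsky coefficients of a uniform moment vector. -/
def firstCoeffLaw (d n : ℕ) : Measure (Fin d → ℝ) :=
  Measure.pi fun j => symBeta (2 * n - 1 - 1 - j)

lemma integral_firstCoeffLaw {d n : ℕ} (hn : 0 < n) (G : (Fin d → ℝ) → ℝ) :
    ∫ α, G α ∂(firstCoeffLaw d n) =
      ∫ s : Fin d → ℝ, (∏ j : Fin d, scaledDensity n j (s j)) * G ((2 * √(n : ℝ))⁻¹ • s) := by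
  have hsq : 0 < √(n : ℝ) := Real.sqrt_pos.2 (by exact_mod_cast hn)
  rw [firstCoeffLaw, pi_symBeta, integral_withDensity_eq_integral_toReal_smul]
  · have hnn : ∀ α : Fin d → ℝ,
        0 ≤ ∏ i : Fin d, betaWeight (2 * n - 1 - 1 - i) (α i) / betaMass (2 * n - 1 - 1 - i) :=
      fun α => Finset.prod_nonneg fun i _ => div_nonneg (betaWeight_nonneg _ _) (betaMass_pos _).le
    simp_rw [ENNReal.toReal_ofReal (hnn _), smul_eq_mul]
    have h := Measure.integral_comp_smul (volume : Measure (Fin d → ℝ))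
      (fun α => (∏ i : Fin d, betaWeight (2 * n - 1 - 1 - i) (α i) / betaMass (2 * n - 1 - 1 - i)) *
        G α) ((2 * √(n : ℝ))⁻¹)
    have hpos : (0 : ℝ) < ((2 * √(n : ℝ))⁻¹) ^ d := by positivity
    rw [Module.finrank_fin_fun, abs_of_pos (inv_pos.2 hpos), smul_eq_mul,
      eq_inv_mul_iff_mul_eq₀ hpos.ne', ← integral_const_mul] at h
    rw [← h]
    refine integral_congr_ae (ae_of_all _ fun s => ?_)
    simp only [scaledDensity, Finset.prod_mul_distrib, Finset.prod_const, Finset.card_univ,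
      Fintype.card_fin, Pi.smul_apply, smul_eq_mul]
    ring
  · refine Measurable.ennreal_ofReal ?_
    exact Finset.measurable_prod _ fun i _ =>
      ((measurable_betaWeight _).comp (measurable_pi_apply i)).div_const _
  · exact ae_of_all _ fun _ => ENNReal.ofReal_lt_top

lemma integral_pi_gaussianReal {d : ℕ} (G : (Fin d → ℝ) → ℝ) :
    ∫ s, G s ∂(Measure.pi fun _ : Fin d => gaussianReal 0 1) =
      ∫ s : Fin d → ℝ, (∏ j, gaussianPDFReal 0 1 (s j)) * G s := by
  have h1 : gaussianReal 0 1 =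
      volume.withDensity fun x => ENNReal.ofReal (gaussianPDFReal 0 1 x) :=
    gaussianReal_of_var_ne_zero 0 one_ne_zero
  rw [h1, pi_withDensity_ofReal (fun _ x => gaussianPDFReal_nonneg 0 1 x)
    (fun _ => integrable_gaussianPDFReal 0 1), integral_withDensity_eq_integral_toReal_smul]
  · have hnn : ∀ s : Fin d → ℝ, 0 ≤ ∏ i : Fin d, gaussianPDFReal 0 1 (s i) :=
      fun s => Finset.prod_nonneg fun i _ => gaussianPDFReal_nonneg 0 1 _
    simp_rw [ENNReal.toReal_ofReal (hnn _), smul_eq_mul]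
  · exact (Finset.measurable_prod _ fun i _ =>
      (measurable_gaussianPDFReal 0 1).comp (measurable_pi_apply i)).ennreal_ofReal
  · exact ae_of_all _ fun _ => ENNReal.ofReal_lt_top

/-- Rescaled Verblunsky coefficients are asymptotically standard Gaussian, in a form that allows for
functions depending on `n`. -/
lemma tendsto_integral_firstCoeffLaw {d : ℕ} {G : ℕ → (Fin d → ℝ) → ℝ} {H : (Fin d → ℝ) → ℝ}
    (hmeas : ∀ n, Measurable (G n)) {K : ℝ} (hK : ∀ n α, ‖G n α‖ ≤ K)
    (hlim : ∀ s, Tendsto (fun n : ℕ => G n ((2 * √(n : ℝ))⁻¹ • s)) atTop (𝓝 (H s))) :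
    Tendsto (fun n => ∫ α, G n α ∂(firstCoeffLaw d n)) atTop
      (𝓝 (∫ s, H s ∂(Measure.pi fun _ : Fin d => gaussianReal 0 1))) := by
  have hmain : Tendsto (fun n : ℕ => ∫ s : Fin d → ℝ,
      (∏ j : Fin d, scaledDensity n j (s j)) * G n ((2 * √(n : ℝ))⁻¹ • s)) atTop
      (𝓝 (∫ s : Fin d → ℝ, (∏ j, gaussianPDFReal 0 1 (s j)) * H s)) := by
    refine tendsto_integral_filter_of_dominated_convergence
      (fun s => (∏ j : Fin d, Real.exp (-(1 / 4) * s j ^ 2)) * K) ?_ ?_ ?_ ?_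
    · refine Eventually.of_forall fun n => Measurable.aestronglyMeasurable ?_
      refine Measurable.mul (Finset.measurable_prod Finset.univ fun (j : Fin d) _ =>
        (measurable_scaledDensity n j).comp (measurable_pi_apply j)) ?_
      exact (hmeas n).comp (measurable_const_smul _)
    · have : ∀ᶠ n : ℕ in atTop, ∀ j : Fin d, ∀ s,
          ‖scaledDensity n j s‖ ≤ Real.exp (-(1 / 4) * s ^ 2) :=
        eventually_all.2 fun j => scaledDensity_le j
      filter_upwards [this] with n hn
      refine ae_of_all _ fun s => ?_
      rw [norm_mul, norm_prod]
      refine mul_le_mul ?_ (hK _ _) (norm_nonneg _) (Finset.prod_nonneg fun _ _ => (Real.exp_pos _).le)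
      exact Finset.prod_le_prod (fun _ _ => norm_nonneg _) fun j _ => hn j _
    · refine Integrable.mul_const ?_ _
      exact Integrable.fintype_prod fun _ => integrable_exp_quarter
    · refine ae_of_all _ fun s => ?_
      exact (tendsto_finsetProd Finset.univ fun (j : Fin d) _ => tendsto_scaledDensity j (s j)).mul (hlim s)
  rw [integral_pi_gaussianReal]
  refine hmain.congr' ?_
  filter_upwards [eventually_gt_atTop 0] with n hn
  rw [integral_firstCoeffLaw hn]

end RandomOrthPoly
end

noncomputable section

open Polynomial

namespace RandomOrthPoly

/-! ### Measurability of the polynomials -/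

lemma measurable_momentCoord {N : ℕ} (k : ℕ) :
    Measurable fun c : Fin N → ℝ => momentCoord c k := by
  cases k with
  | zero => exact measurable_const
  | succ k =>
    by_cases h : k < N
    · simpa only [momentCoord, h, dif_pos] using measurable_pi_apply _
    · simpa only [momentCoord, h, dif_neg, not_false_iff] using measurable_const

lemma measurable_det {Ω : Type*} [MeasurableSpace Ω] {n : ℕ} {A : Ω → Matrix (Fin n) (Fin n) ℝ}
    (hA : ∀ i j, Measurable fun ω => A ω i j) : Measurable fun ω => (A ω).det := by
  simp only [Matrix.det_apply]
  exact Finset.measurable_sum _ fun σ _ =>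
    (Finset.measurable_prod _ fun i _ => hA (σ i) i).const_smul _

lemma measurable_eval_orthPoly {N : ℕ} (m : ℕ) (x : ℝ) :
    Measurable fun c : Fin N → ℝ => (orthPoly c m).eval x := by
  simp only [orthPoly, eval_mul, eval_C, hankelDet]
  refine (measurable_det fun i j => measurable_momentCoord _).inv.mul ?_
  simp only [← coe_evalRingHom, RingHom.map_det]
  refine measurable_det fun i j => ?_
  by_cases h : (j : ℕ) < m
  · simpa [h] using measurable_momentCoord _
  · simp [h]

lemma measurable_eval_verblunskyPoly {N : ℕ} (m : ℕ) (x : ℝ) :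
    Measurable fun α : Fin N → ℝ => (verblunskyPoly (extend α) m).eval x := by
  simp only [verblunskyPoly, eval_mul, eval_C, eval_finsetSum]
  refine Measurable.const_mul (Finset.measurable_sum _ fun i _ => Measurable.mul_const ?_ _) _
  exact (contDiff_szego_coeff (2 * m - 1) i).1.continuous.measurable

/-! ### Roots of the orthogonal polynomial of a uniform moment vector -/

lemma ae_symBeta_mem_Ioo (K : ℕ) : ∀ᵐ x ∂(symBeta K), x ∈ Set.Ioo (-1 : ℝ) 1 := by
  rw [symBeta, ae_withDensity_iff
    ((measurable_betaWeight K).div_const _).ennreal_ofReal]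
  refine ae_of_all _ fun x hx => ?_
  by_contra h
  simp [betaWeight, Set.indicator_of_notMem h] at hx

lemma ae_mem_openCube (N : ℕ) : ∀ᵐ α ∂(verblunskyLaw N), α ∈ openCube N := by
  have h : ∀ j : Fin N, ∀ᵐ α ∂(verblunskyLaw N), α j ∈ Set.Ioo (-1 : ℝ) 1 := fun _ =>
    Measure.tendsto_eval_ae_ae.eventually (ae_symBeta_mem_Ioo _)
  filter_upwards [ae_all_iff.2 h] with α hα
  exact fun j _ => hα j

/-- Truncation to the first 2m-1 coefficients makes the polynomial one fixed function for all n;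
only the law of its argument changes. -/
lemma orthPoly_momentMap_eq {m n : ℕ} (hm : 1 ≤ m) (h : 2 * m - 1 ≤ 2 * n - 1)
    {α : Fin (2 * n - 1) → ℝ} (hα : α ∈ openCube (2 * n - 1)) :
    orthPoly (momentMap (2 * n - 1) α) m =
      verblunskyPoly (extend fun j : Fin (2 * m - 1) => α (Fin.castLE h j)) m := by
  rw [(orthPoly_momentMap hm (by omega) hα).1]
  refine verblunskyPoly_congr fun j hj => ?_
  rw [extend_of_lt _ hj, extend_of_lt _ (hj.trans_le h)]
  rfl

lemma verblunskyPoly_splits {m : ℕ} (hm : 1 ≤ m) {α : Fin (2 * m - 1) → ℝ}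
    (hα : α ∈ openCube (2 * m - 1)) : (verblunskyPoly (extend α) m).Splits :=
  (orthPoly_momentMap hm (by omega) hα).2

lemma orthPoly_spec {m n : ℕ} (hm : 1 ≤ m) (hn : m ≤ n) {c : Fin (2 * n - 1) → ℝ}
    (hc : c ∈ momentMap (2 * n - 1) '' openCube (2 * n - 1)) :
    (orthPoly c m).Monic ∧ (orthPoly c m).natDegree = m ∧ (orthPoly c m).Splits := by
  obtain ⟨α, hα, rfl⟩ := hc
  obtain ⟨h1, h2⟩ := orthPoly_momentMap hm (N := 2 * n - 1) (by omega) hα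
  rw [h1]
  exact ⟨verblunskyPoly_monic _ hm, verblunskyPoly_natDegree _ hm, h2⟩

lemma eventually_smul_mem_openCube {d : ℕ} (s : Fin d → ℝ) :
    ∀ᶠ n : ℕ in atTop, (2 * √(n : ℝ))⁻¹ • s ∈ openCube d := by
  have h : ∀ j : Fin d, ∀ᶠ n : ℕ in atTop, (2 * √(n : ℝ))⁻¹ * s j ∈ Set.Ioo (-1 : ℝ) 1 := fun j => by
    have h0 : Tendsto (fun n : ℕ => (2 * √(n : ℝ))⁻¹ * s j) atTop (𝓝 0) := by
      simpa using tendsto_inv_two_mul_sqrt.mul_const (s j)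
    exact h0 (Ioo_mem_nhds neg_one_lt_zero one_pos)
  filter_upwards [eventually_all.2 h] with n hn
  exact fun j _ => hn j

section Uniform

variable {Ω : ℕ → Type*} [∀ n, MeasurableSpace (Ω n)] {μ : (n : ℕ) → Measure (Ω n)}
  {C : (n : ℕ) → Ω n → (Fin (2 * n - 1) → ℝ)}

lemma aemeasurable_of_isUniform {n : ℕ}
    (hC : pdf.IsUniform (C n) (momentSpace (2 * n - 1)) (μ n) volume) : AEMeasurable (C n) (μ n) :=
  pdf.IsUniform.aemeasurable (volume_momentSpace_ne_zero _) (volume_momentSpace_ne_top _) hC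

lemma ae_mem_image_of_isUniform {n : ℕ}
    (hC : pdf.IsUniform (C n) (momentSpace (2 * n - 1)) (μ n) volume) :
    ∀ᵐ ω ∂(μ n), C n ω ∈ momentMap (2 * n - 1) '' openCube (2 * n - 1) := by
  refine ae_of_ae_map (aemeasurable_of_isUniform hC) ?_
  rw [show (μ n).map (C n) = _ from hC]
  exact ae_mem_image_openCube _

/-- The law of a function of the `m`-th orthogonal polynomial, in terms of the first Verblunsky
coefficients. -/
lemma integral_comp_orthPoly {m n : ℕ} (hm : 1 ≤ m) (hn : m ≤ n)
    (hC : pdf.IsUniform (C n) (momentSpace (2 * n - 1)) (μ n) volume) {Φ : (Fin m → ℝ) → ℝ}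
    (hΦ : Measurable Φ) :
    ∫ ω, Φ (fun i => (orthPoly (C n ω) m).eval (i : ℝ)) ∂(μ n) =
      ∫ α, Φ (fun i => (verblunskyPoly (extend α) m).eval (i : ℝ))
        ∂(firstCoeffLaw (2 * m - 1) n) := by
  have hle : 2 * m - 1 ≤ 2 * n - 1 := by omega
  have hcm : Measurable fun c : Fin (2 * n - 1) → ℝ =>
      Φ (fun i => (orthPoly c m).eval (i : ℝ)) :=
    hΦ.comp (measurable_pi_lambda _ fun i => measurable_eval_orthPoly m _)
  have hvm : Measurable fun α : Fin (2 * m - 1) → ℝ =>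
      Φ (fun i => (verblunskyPoly (extend α) m).eval (i : ℝ)) :=
    hΦ.comp (measurable_pi_lambda _ fun i => measurable_eval_verblunskyPoly m _)
  have hres : Measurable fun (α : Fin (2 * n - 1) → ℝ) (j : Fin (2 * m - 1)) =>
      α (Fin.castLE hle j) := measurable_pi_lambda _ fun _ => measurable_pi_apply _
  have hlaw : (verblunskyLaw (2 * n - 1)).map (fun α (j : Fin (2 * m - 1)) => α (Fin.castLE hle j)) =
      firstCoeffLaw (2 * m - 1) n := map_castLE_pi hle _
  rw [← integral_map (aemeasurable_of_isUniform hC) hcm.aestronglyMeasurable,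
    show (μ n).map (C n) = _ from hC, cond_momentSpace,
    integral_map (contDiff_momentMap _).continuous.measurable.aemeasurable hcm.aestronglyMeasurable,
    ← hlaw, integral_map hres.aemeasurable hvm.aestronglyMeasurable]
  refine integral_congr_ae ?_
  filter_upwards [ae_mem_openCube (2 * n - 1)] with α hα
  rw [orthPoly_momentMap_eq hm hle hα]

end Uniform

end RandomOrthPoly
end

/-! ### The limit theorem -/

theorem theorem3p3 (m : ℕ) (hm : 1 ≤ m)
    {Ω : ℕ → Type*} [∀ n, MeasurableSpace (Ω n)]
    (μ : (n : ℕ) → Measure (Ω n)) [∀ n, IsProbabilityMeasure (μ n)]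
    (C : (n : ℕ) → Ω n → (Fin (2 * n - 1) → ℝ))
    (hC : ∀ n, 1 ≤ n → pdf.IsUniform (C n) (RandomOrthPoly.momentSpace (2 * n - 1)) (μ n) volume) :
    (∀ n, m ≤ n → ∀ᵐ ω ∂(μ n), RandomOrthPoly.orthPoly (C n ω) m =
        ∏ k : Fin m,
          (Polynomial.X - Polynomial.C (RandomOrthPoly.rootVector m n (C n ω) k))) ∧
      (RandomOrthPoly.limitCov m).PosSemidef ∧
      TendstoInDistribution
        (fun (n : ℕ) (ω : Ω n) => (4 * √(n : ℝ)) •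
          (RandomOrthPoly.rootVector m n (C n ω) - RandomOrthPoly.chebRoots m))
        atTop (id : EuclideanSpace ℝ (Fin m) → EuclideanSpace ℝ (Fin m)) μ
        (multivariateGaussian 0 (RandomOrthPoly.limitCov m)) := by
  have hCn : ∀ n, m ≤ n →
      pdf.IsUniform (C n) (RandomOrthPoly.momentSpace (2 * n - 1)) (μ n) volume :=
    fun n hn => hC n (hm.trans hn)
  obtain ⟨g, hg, hgP⟩ := RandomOrthPoly.exists_measurable_orderedRoots m
  have hroot : ∀ n, m ≤ n → ∀ᵐ ω ∂(μ n), RandomOrthPoly.rootVector m n (C n ω) =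
      g fun i => (RandomOrthPoly.orthPoly (C n ω) m).eval (i : ℝ) := by
    intro n hn
    filter_upwards [RandomOrthPoly.ae_mem_image_of_isUniform (hCn n hn)] with ω hω
    obtain ⟨h1, h2, h3⟩ := RandomOrthPoly.orthPoly_spec hm hn hω
    rw [RandomOrthPoly.rootVector, if_pos hn, hgP _ h1 h2 h3]
  have hscale : ∀ n : ℕ, Measurable fun v : EuclideanSpace ℝ (Fin m) =>
      (4 * √(n : ℝ)) • (v - RandomOrthPoly.chebRoots m) := fun n =>
    Continuous.measurable (by fun_prop)
  have hae : ∀ n : ℕ, AEMeasurable (fun ω => (4 * √(n : ℝ)) •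
      (RandomOrthPoly.rootVector m n (C n ω) - RandomOrthPoly.chebRoots m)) (μ n) := by
    intro n
    by_cases hn : m ≤ n
    · refine (hscale n).comp_aemeasurable (AEMeasurable.congr ?_
        ((hroot n hn).mono fun _ h => h.symm))
      refine hg.comp_aemeasurable ?_
      exact (measurable_pi_lambda _ fun i =>
        RandomOrthPoly.measurable_eval_orthPoly m _).comp_aemeasurable
          (RandomOrthPoly.aemeasurable_of_isUniform (hCn n hn))
    · simp only [RandomOrthPoly.rootVector, if_neg hn]
      exact aemeasurable_const
  refine ⟨fun n hn => ?_, RandomOrthPoly.limitCov_posSemidef hm, ⟨hae, aemeasurable_id, ?_⟩⟩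
  · filter_upwards [RandomOrthPoly.ae_mem_image_of_isUniform (hCn n hn)] with ω hω
    obtain ⟨h1, h2, h3⟩ := RandomOrthPoly.orthPoly_spec hm hn hω
    rw [RandomOrthPoly.rootVector, if_pos hn]
    exact (RandomOrthPoly.orderedRoots_spec h1 h2 h3).2
  · refine ProbabilityMeasure.tendsto_iff_forall_integral_tendsto.2 fun F => ?_
    have hF : Measurable F := F.continuous.measurable
    have hΨ : ∀ n : ℕ, Measurable fun y : Fin m → ℝ =>
        F ((4 * √(n : ℝ)) • (g y - RandomOrthPoly.chebRoots m)) := fun n =>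
      hF.comp ((hscale n).comp hg)
    -- The test function of the scaled roots is pulled back to the Verblunsky coefficients. It
    -- depends on n through the scale, and the perturbation of the roots along each direction s
    -- supplies its pointwise limit.
    have hlim := RandomOrthPoly.tendsto_integral_firstCoeffLaw (d := 2 * m - 1) (K := ‖F‖)
      (G := fun n α => F ((4 * √(n : ℝ)) •
        (g (fun i => (RandomOrthPoly.verblunskyPoly (RandomOrthPoly.extend α) m).eval (i : ℝ)) -
          RandomOrthPoly.chebRoots m)))
      (H := fun s => F (WithLp.toLp 2 ((RandomOrthPoly.rootJacobian m).mulVec s)))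
      (fun n => (hΨ n).comp (measurable_pi_lambda _ fun i =>
        RandomOrthPoly.measurable_eval_verblunskyPoly m _))
      (fun n α => F.norm_coe_le_norm _) ?_
    · have hZ : ∫ s, F (WithLp.toLp 2 ((RandomOrthPoly.rootJacobian m).mulVec s))
          ∂(Measure.pi fun _ : Fin (2 * m - 1) => gaussianReal 0 1) =
          ∫ z, F z ∂(multivariateGaussian 0 (RandomOrthPoly.limitCov m)) := by
        rw [RandomOrthPoly.limitCov_eq hm, ← RandomOrthPoly.map_mulVec_pi_gaussianReal,
          integral_map _ hF.aestronglyMeasurable]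
        exact ((PiLp.continuous_toLp 2 _).comp
          (Continuous.matrix_mulVec continuous_const continuous_id)).measurable.aemeasurable
      rw [hZ] at hlim
      simp only [ProbabilityMeasure.coe_mk, Measure.map_id]
      refine hlim.congr' ?_
      filter_upwards [eventually_ge_atTop m] with n hn
      rw [integral_map (hae n) hF.aestronglyMeasurable,
        ← RandomOrthPoly.integral_comp_orthPoly hm hn (hCn n hn) (hΨ n)]
      refine integral_congr_ae ?_
      filter_upwards [hroot n hn] with ω hω
      rw [hω]
    · intro s
      refine ((F.continuous.tendsto _).comp
        (RandomOrthPoly.tendsto_scaled_orderedRoots hm s)).congr' ?_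
      -- `g` is known to give the ordered roots only for polynomials that split, which holds once
      -- the scaled point has entered the open cube.
      filter_upwards [RandomOrthPoly.eventually_smul_mem_openCube s] with n hn
      simp only [Function.comp_apply]
      rw [hgP _ (RandomOrthPoly.verblunskyPoly_monic _ hm)
        (RandomOrthPoly.verblunskyPoly_natDegree _ hm) (RandomOrthPoly.verblunskyPoly_splits hm hn)]
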